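/- Let $\{\lambda_n\}_{n\ge 1}$ be an admissible scale, i.e. a sequence of positive numbers with $\lambda_n/\log n\to\infty$ and $n/\lambda_n^2\to\infty$ as $n\to\infty$. Let $r,s\ge 0$ be integers with $\ell=\frac{s+1-r}{2}>0$, let $\alpha_1,\dots,\alpha_r,\beta_1,\dots,\beta_s>0$ be real, and put $\rho=\sum_{j=1}^r\alpha_j-\sum_{k=1}^s\beta_k-1$. For $v\in\mathbb R$ let $z=e^{2\pi v}$ and $q=e^{-\pi/\lambda_n}$. With $(a;q)_\infty=\prod_{i\ge 0}(1-aq^i)$, $(a;q)_k=(a;q)_\infty/(aq^k;q)_\infty$ and $(a_1,\dots,a_m;q)_k=\prod_{i=1}^m(a_i;q)_k$, define $${}_r\phi_s\left(\begin{matrix}a_1,\dots,a_r\\ b_1,\dots,b_s\end{matrix}\,\Big|\,q,x\right)=\sum_{k=0}^\infty\frac{(a_1,\dots,a_r;q)_k\,(xq^{-\ell})^k\,q^{\ell k^2}}{(q,b_1,\dots,b_s;q)_k\,(-1)^{k(s+1-r)}} .$$ Then the series below converge absolutely for all $n\ge1$ and $v\in\mathbb R$, and, as $n\to\infty$, $${}_r\phi_s\left(\begin{matrix}q^{\alpha_1},\dots,q^{\alpha_r}\\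 q^{\beta_1},\dots,q^{\beta_s}\end{matrix}\,\Big|\,q,(-1)^{s+1-r}zq^{-\ell(4n-1)}\right)=\frac{\prod_{k=1}^s\Gamma(\beta_k)}{\prod_{j=1}^r\Gamma(\alpha_j)}\,\frac{\lambda_n^{\rho+\ell+1/2}}{\sqrt{\ell}\,2^{\ell}\,\pi^{\rho+2\ell}}\exp\left\{\frac{\pi\lambda_n}{\ell}\left(v+\frac{2n\ell}{\lambda_n}\right)^2+\frac{\ell\pi\lambda_n}{3}\right\}\left\{1+\mathcal O(\lambda_n^{-1})\right\}$$ and $${}_r\phi_s\left(\begin{matrix}q^{\alpha_1},\dots,q^{\alpha_r}\\ q^{\beta_1},\dots,q^{\beta_s}\end{matrix}\,\Big|\,q,(-1)^{s-r}zq^{-\ell(4n-1)}\right)=\frac{\prod_{k=1}^s\Gamma(\beta_k)}{\prod_{j=1}^r\Gamma(\alpha_j)}\,\frac{\lambda_n^{\rho+\ell+1/2}}{\sqrt{\ell}\,2^{\ell-1}\,\pi^{\rho+2\ell}}\exp\left\{\frac{\pi\lambda_n}{\ell}\left(v+\frac{2n\ell}{\lambda_n}\right)^2+\frac{\ell\pi\lambda_n}{3}-\frac{\pi\lambda_n}{4\ell}\right\}\left\{\cos\frac{\pi\lambda_nv}{\ell}+\mathcal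 O(\lambda_n^{-1})\right\},$$ where both $\mathcal O$-terms are uniform for $v$ in any compact subset of $\mathbb R$ (for fixed $r,s,\alpha_j,\beta_k$ and fixed sequence $\lambda_n$). -/

import Mathlib

open Filter

/-- The infinite `q`-shifted factorial `(a; q)_∞ = ∏_{k ≥ 0} (1 - a q ^ k)`, for `0 < q < 1`. -/
noncomputable def qPochInf (a : ℂ) (q : ℝ) : ℂ :=
  ∏' k : ℕ, (1 - a * (q : ℂ) ^ k)

/-- The `q`-shifted factorial `(a; q)_n = (a; q)_∞ / (a q ^ n; q)_∞`, for a natural number `n`. -/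
noncomputable def qPoch (a : ℂ) (q : ℝ) (n : ℕ) : ℂ :=
  qPochInf a q / qPochInf (a * (q : ℂ) ^ n) q

/-- The number `ℓ = (s + 1 - r) / 2` attached to a basic hypergeometric series `r φ s`. -/
noncomputable def bhsEll (r s : ℕ) : ℝ := ((s : ℝ) + 1 - r) / 2

/-- The `k`-th term
`(a_1, …, a_r; q)_k (z q ^ (-ℓ)) ^ k q ^ (ℓ k²) / ((q, b_1, …, b_s; q)_k (-1) ^ (k (s + 1 - r)))`
of the basic hypergeometric series `r φ s`. -/
noncomputable def bhsTerm {r s : ℕ} (a : Fin r → ℂ) (b : Fin s → ℂ) (q : ℝ) (z : ℂ) (k : ℕ) : ℂ :=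
  ((∏ j, qPoch (a j) q k) * (z * ((q ^ (-bhsEll r s) : ℝ) : ℂ)) ^ k *
      ((q ^ (bhsEll r s * (k : ℝ) ^ 2) : ℝ) : ℂ)) /
    (qPoch (q : ℂ) q k * (∏ j, qPoch (b j) q k) * (-1 : ℂ) ^ ((k : ℤ) * ((s : ℤ) + 1 - (r : ℤ))))

/-- The basic hypergeometric series `r φ s (a_1, …, a_r; b_1, …, b_s | q, z)`. -/
noncomputable def bhs {r s : ℕ} (a : Fin r → ℂ) (b : Fin s → ℂ) (q : ℝ) (z : ℂ) : ℂ :=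
  ∑' k : ℕ, bhsTerm a b q z k

/-- Admissible scales: sequences `(lam n)_{n ≥ 1}` of positive numbers with
`lam n / log n → ∞` and `n / (lam n)² → ∞`. The value at `n = 0` is irrelevant. -/
structure IsAdmissibleScale (lam : ℕ → ℝ) : Prop where
  pos : ∀ n : ℕ, 1 ≤ n → 0 < lam n
  tendsto_div_log : Tendsto (fun n : ℕ => lam n / Real.log n) atTop atTop
  tendsto_div_sq : Tendsto (fun n : ℕ => (n : ℝ) / lam n ^ 2) atTop atTop

/-- `ε n v = O(1 / lam n)` as `n → ∞`, uniformly for `v` in any compact subset of `ℝ`. -/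
def IsBigOInvLocUnif (lam : ℕ → ℝ) (ε : ℕ → ℝ → ℂ) : Prop :=
  ∀ K : Set ℝ, IsCompact K → ∃ C : ℝ, ∃ N : ℕ, ∀ n : ℕ, N ≤ n → ∀ v ∈ K, ‖ε n v‖ ≤ C / lam n

/-! With q = e^{-h}, h = π/λ_n and a = ℓ/λ_n, the k-th term of either series is a coefficient times
σ^k exp(2πvk - πa(k² - 4nk)), where σ = 1 or σ = -1. Completing the square with k = j + 2n moves the
peak of the Gaussian far to the right. The coefficient there is nearly its limit (q^{α_1}, …,
q^{α_r}; q)_∞ / (q, q^{β_1}, …, q^{β_s}; q)_∞, so the series is close to this limit times an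
explicit exponential times the full theta sum over j ∈ ℤ.

Three estimates make this precise. The relative deviation of the coefficient from its limit is at
most B e^{-hk} for every integer k, with B at most exponential in λ_n
(`abs_bhsCoeffRatio_sub_one_le`, `exists_bhsCoeffBound_le`). After the shift it contributes a factor
e^{-2πn/λ_n}, which beats every e^{Cλ_n} because n/λ_n² → ∞ (`bhsCoeff_series`,
`IsAdmissibleScale.eventually_error_le`).

Poisson summation evaluates the theta sums as a → 0. The dual sum is dominated by n = 0 when σ = 1,
and by the equal-sized pair n = 0, 1 when σ = -1, which produces the cosine and the loss
exp(-π/(4a)) (`exists_abs_theta_sub_le`, `exists_abs_alternating_theta_sub_le`).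

The limit coefficient needs (q^c; q)_∞ with relative error O(h). For c = 1 this is the modular
transformation of the eta function (`expPochInf_one_transform`). For general c > 0 the quotient by
(q; q)_∞ is compared with Euler's product for Γ(c), the discrepancy being controlled by convexity in
c (`exists_abs_qGammaDefect_le`). -/

/-! ### Bounds and convexity for log((1 - e^{-t})/t) -/

/-- The function `log ((1 - exp (-t)) / t)`, a smooth convex function on `(0, ∞)`. -/
noncomputable def logExpQuot (t : ℝ) : ℝ := Real.log ((1 - Real.exp (-t)) / t)

lemma one_sub_exp_neg_pos {t : ℝ} (ht : 0 < t) : 0 < 1 - Real.exp (-t) := by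
  have := Real.exp_lt_exp.2 (neg_lt_zero.2 ht)
  rw [Real.exp_zero] at this
  linarith

lemma one_sub_exp_neg_eq {t : ℝ} (ht : 0 < t) :
    1 - Real.exp (-t) = t * Real.exp (logExpQuot t) := by
  have := one_sub_exp_neg_pos ht
  rw [logExpQuot, Real.exp_log (by positivity)]
  field_simp

lemma hasDerivAt_logExpQuot {t : ℝ} (ht : 0 < t) :
    HasDerivAt logExpQuot (1 / (Real.exp t - 1) - 1 / t) t := by
  have h1 := one_sub_exp_neg_pos ht
  have h2 : HasDerivAt (fun t : ℝ => (1 - Real.exp (-t)) / t)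
      ((Real.exp (-t) * t - (1 - Real.exp (-t)) * 1) / t ^ 2) t := by
    refine HasDerivAt.div ?_ (hasDerivAt_id t) ht.ne'
    simpa using ((hasDerivAt_id t).neg.exp).const_sub 1
  refine (h2.log (by positivity)).congr_deriv ?_
  have h4 : 0 < Real.exp t - 1 := by have := Real.add_one_lt_exp ht.ne'; linarith
  have h5 : Real.exp (-t) = (Real.exp t)⁻¹ := Real.exp_neg t
  have h6 := Real.exp_pos t
  rw [h5] at h1 ⊢
  have h7 : 1 - (Real.exp t)⁻¹ = (Real.exp t - 1) / Real.exp t := by field_simp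
  rw [h7]
  field_simp

lemma abs_deriv_logExpQuot_le {t : ℝ} (ht : 0 < t) : |1 / (Real.exp t - 1) - 1 / t| ≤ 1 := by
  have h4 : t < Real.exp t - 1 := by have := Real.add_one_lt_exp ht.ne'; linarith
  have h1 : 1 - Real.exp (-t) ≤ t := by have := Real.add_one_le_exp (-t); linarith
  have h0 := one_sub_exp_neg_pos ht
  have h5 : 1 / (Real.exp t - 1) + 1 = 1 / (1 - Real.exp (-t)) := by
    have h6 := Real.exp_pos t
    have h7 : 1 - (Real.exp t)⁻¹ = (Real.exp t - 1) / Real.exp t := by field_simp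
    have h8 : 0 < Real.exp t - 1 := by linarith
    rw [Real.exp_neg, h7]
    field_simp
    ring
  have h6 : 1 / t ≤ 1 / (1 - Real.exp (-t)) := one_div_le_one_div_of_le h0 h1
  have h7 : 1 / (Real.exp t - 1) ≤ 1 / t := one_div_le_one_div_of_le ht h4.le
  rw [abs_le]; constructor <;> linarith

lemma abs_logExpQuot_sub_le {x y : ℝ} (hx : 0 < x) (hy : 0 < y) :
    |logExpQuot y - logExpQuot x| ≤ |y - x| := by
  have := Convex.norm_image_sub_le_of_norm_hasDerivWithin_le (f := logExpQuot) (s := Set.Ioi 0)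
    (C := 1) (fun t ht => (hasDerivAt_logExpQuot ht).hasDerivWithinAt)
    (fun t ht => abs_deriv_logExpQuot_le ht) (convex_Ioi 0) hx hy
  simpa using this

lemma abs_logExpQuot_le {t : ℝ} (ht : 0 < t) : |logExpQuot t| ≤ t := by
  have h1 : 1 - Real.exp (-t) ≤ t := by have := Real.add_one_le_exp (-t); linarith
  have h0 := one_sub_exp_neg_pos ht
  have h2 : Real.exp (-t) ≤ (1 - Real.exp (-t)) / t := by
    rw [le_div_iff₀ ht]
    have h3 : Real.exp (-t) * Real.exp t = 1 := by rw [← Real.exp_add]; simp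
    have h4 := Real.add_one_le_exp t
    nlinarith [Real.exp_pos (-t)]
  rw [logExpQuot, abs_le]
  constructor
  · rw [Real.le_log_iff_exp_le (by positivity)]; exact h2
  · refine (Real.log_nonpos (by positivity) ?_).trans ht.le
    rw [div_le_one ht]; exact h1

/-- Convexity passes to `qGammaDefect` as a function of c and there allows interpolation between
integers, in the spirit of Bohr–Mollerup. -/
lemma convexOn_logExpQuot : ConvexOn ℝ (Set.Ioi 0) logExpQuot := by
  have hd : ∀ t ∈ Set.Ioi (0 : ℝ), deriv logExpQuot t = 1 / (Real.exp t - 1) - 1 / t :=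
    fun t ht => (hasDerivAt_logExpQuot ht).deriv
  refine MonotoneOn.convexOn_of_deriv (convex_Ioi 0)
    (fun t ht => (hasDerivAt_logExpQuot ht).continuousAt.continuousWithinAt) ?_ ?_
  · rw [interior_Ioi]
    exact fun t ht => (hasDerivAt_logExpQuot ht).differentiableAt.differentiableWithinAt
  · rw [interior_Ioi]
    refine MonotoneOn.congr ?_ (fun t ht => (hd t ht).symm)
    have hder : ∀ t ∈ Set.Ioi (0 : ℝ), HasDerivAt (fun t => 1 / (Real.exp t - 1) - 1 / t)
        (-Real.exp t / (Real.exp t - 1) ^ 2 - -1 / t ^ 2) t := by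
      intro t ht
      have ht : 0 < t := ht
      have h8 : 0 < Real.exp t - 1 := by have := Real.add_one_lt_exp ht.ne'; linarith
      simp only [one_div]
      exact (((Real.hasDerivAt_exp t).sub_const 1).inv h8.ne').sub ((hasDerivAt_id t).inv ht.ne')
    refine monotoneOn_of_deriv_nonneg (convex_Ioi 0)
      (fun t ht => (hder t ht).continuousAt.continuousWithinAt) ?_ ?_
    · rw [interior_Ioi]
      exact fun t ht => (hder t ht).differentiableAt.differentiableWithinAt
    · rw [interior_Ioi]
      intro t ht
      rw [(hder t ht).deriv]
      have ht : 0 < t := ht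
      have h8 : 0 < Real.exp t - 1 := by have := Real.add_one_lt_exp ht.ne'; linarith
      -- The second derivative is 1/t² - e^t/(e^t - 1)², whose nonnegativity amounts to t/2 ≤
      -- sinh(t/2).
      have h9 : t / 2 ≤ Real.sinh (t / 2) := Real.self_le_sinh_iff.2 (by positivity)
      rw [Real.sinh_eq] at h9
      set e := Real.exp (t / 2) with he
      have he0 : 0 < e := Real.exp_pos _
      have h10 : Real.exp t = e ^ 2 := by rw [he, ← Real.exp_nat_mul]; congr 1; push_cast; ring
      have h11 : Real.exp (-(t / 2)) = e⁻¹ := Real.exp_neg _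
      rw [h11] at h9
      have h12 : t * e ≤ e ^ 2 - 1 := by
        have : t * e ≤ (e - e⁻¹) * e := by gcongr; linarith
        have h13 : (e - e⁻¹) * e = e ^ 2 - 1 := by field_simp
        linarith
      rw [h10] at h8 ⊢
      have h14 : e ^ 2 / (e ^ 2 - 1) ^ 2 ≤ 1 / t ^ 2 := by
        rw [div_le_div_iff₀ (by positivity) (by positivity)]
        have : (t * e) ^ 2 ≤ (e ^ 2 - 1) ^ 2 := by gcongr
        nlinarith
      have : -e ^ 2 / (e ^ 2 - 1) ^ 2 - -1 / t ^ 2 = 1 / t ^ 2 - e ^ 2 / (e ^ 2 - 1) ^ 2 := by ring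
      rw [this]; linarith

/-! ### The q-Gamma defect is O(h), uniformly in N -/

/-- The discrepancy, on the logarithmic scale, between the `N`-th partial product of the `q`-Gamma
function at `c`, `q = exp (-h)`, and that of the Gamma function. -/
noncomputable def qGammaDefect (h : ℝ) (N : ℕ) (c : ℝ) : ℝ :=
  ∑ j ∈ Finset.range (N + 1), logExpQuot ((c + j) * h) -
    ∑ j ∈ Finset.range N, logExpQuot ((1 + j) * h) - c * logExpQuot (N * h)

/-- Raising c by one shifts the first sum by one index, so it telescopes to its two end terms. -/
lemma qGammaDefect_add_one (h : ℝ) (N : ℕ) (c : ℝ) :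
    qGammaDefect h N (c + 1) - qGammaDefect h N c =
      logExpQuot ((c + (N + 1)) * h) - logExpQuot (c * h) - logExpQuot (N * h) := by
  have h1 : ∑ j ∈ Finset.range (N + 1), logExpQuot ((c + 1 + j) * h) + logExpQuot (c * h) =
      ∑ j ∈ Finset.range (N + 1), logExpQuot ((c + j) * h) +
        logExpQuot ((c + (N + 1)) * h) := by
    have h2 := Finset.sum_range_succ (fun j : ℕ => logExpQuot ((c + j) * h)) (N + 1)
    have h3 := Finset.sum_range_succ' (fun j : ℕ => logExpQuot ((c + j) * h)) (N + 1)
    rw [h3] at h2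
    push_cast at h2
    simp only [add_zero] at h2
    rw [← h2]
    congr 2
    ext j; congr 2; ring
  unfold qGammaDefect
  linarith

lemma abs_qGammaDefect_add_one_sub_le {h : ℝ} (hh : 0 < h) {N : ℕ} (hN : 1 ≤ N) {c : ℝ}
    (hc : 0 < c) : |qGammaDefect h N (c + 1) - qGammaDefect h N c| ≤ (2 * c + 1) * h := by
  have hN' : (0 : ℝ) < N := by exact_mod_cast hN
  rw [qGammaDefect_add_one]
  have h1 := abs_logExpQuot_sub_le (x := N * h) (y := (c + (N + 1)) * h) (by positivity)
    (by positivity)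
  have h2 := abs_logExpQuot_le (t := c * h) (by positivity)
  have h3 : |(c + (N + 1)) * h - N * h| = (c + 1) * h := by
    rw [show (c + (N + 1)) * h - N * h = (c + 1) * h by ring]
    exact abs_of_pos (by positivity)
  rw [h3] at h1
  rw [abs_le] at *
  constructor <;> linarith [h1.1, h1.2, h2.1, h2.2]

lemma convexOn_qGammaDefect {h : ℝ} (hh : 0 < h) (N : ℕ) :
    ConvexOn ℝ (Set.Ioi 0) (qGammaDefect h N) := by
  refine ⟨convex_Ioi 0, fun x hx y hy a b ha hb hab => ?_⟩
  have hx : 0 < x := hx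
  have hy : 0 < y := hy
  have key : ∀ j : ℕ, logExpQuot ((a * x + b * y + j) * h) ≤
      a * logExpQuot ((x + j) * h) + b * logExpQuot ((y + j) * h) := by
    intro j
    have := convexOn_logExpQuot.2 (x := (x + j) * h) (y := (y + j) * h)
      (by simp only [Set.mem_Ioi]; positivity) (by simp only [Set.mem_Ioi]; positivity) ha hb hab
    simp only [smul_eq_mul] at this
    rwa [show a * ((x + j) * h) + b * ((y + j) * h) = (a * x + b * y + j) * h by
      linear_combination ((j : ℝ) * h) * hab] at this
  have hs := Finset.sum_le_sum (s := Finset.range (N + 1)) (fun j _ => key j)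
  rw [Finset.sum_add_distrib, ← Finset.mul_sum, ← Finset.mul_sum] at hs
  simp only [qGammaDefect, smul_eq_mul]
  have hb' : b = 1 - a := by linarith
  subst hb'
  linarith

/-- At c = 1 the two sums cancel up to one difference of values at points h apart. Each further unit
step costs O(h). The constant does not depend on N, which later permits N → ∞ at fixed h. -/
lemma exists_abs_qGammaDefect_natCast_le (m : ℕ) : ∃ C : ℝ, ∀ h : ℝ, 0 < h → ∀ N : ℕ, 1 ≤ N →
    |qGammaDefect h N (m + 1)| ≤ C * h := by
  induction m with
  | zero =>
    refine ⟨1, fun h hh N hN => ?_⟩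
    have hN' : (0 : ℝ) < N := by exact_mod_cast hN
    have h1 : qGammaDefect h N (0 + 1) = logExpQuot ((1 + N) * h) - logExpQuot (N * h) := by
      simp only [qGammaDefect, Finset.sum_range_succ]
      simp only [zero_add]
      ring
    push_cast
    rw [h1]
    refine (abs_logExpQuot_sub_le (by positivity) (by positivity)).trans ?_
    rw [show (1 + N) * h - N * h = h by ring, abs_of_pos hh]; linarith
  | succ m ih =>
    obtain ⟨C, hC⟩ := ih
    refine ⟨C + (2 * (m + 1) + 1), fun h hh N hN => ?_⟩
    have h1 := abs_qGammaDefect_add_one_sub_le hh hN (c := m + 1) (by positivity)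
    have h2 := hC h hh N hN
    push_cast
    rw [abs_le] at *
    constructor <;> linarith [h1.1, h1.2, h2.1, h2.2]

/-- A convex function that is O(h) at three consecutive integers is O(h) between the first two: the
chord bounds it above, and extrapolation from the next integer bounds it below. The argument is run
at c + 1, so that the integers used are at least 1, and one unit step then returns to c. -/
lemma exists_abs_qGammaDefect_le {c : ℝ} (hc : 0 < c) : ∃ C : ℝ, ∀ h : ℝ, 0 < h → ∀ N : ℕ,
    1 ≤ N → |qGammaDefect h N c| ≤ C * h := by
  obtain ⟨m, t, ht0, ht1, hm⟩ : ∃ (m : ℕ) (t : ℝ), 0 < t ∧ t ≤ 1 ∧ c + 1 = m + 1 + 1 - t := by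
    refine ⟨⌊c⌋₊, ⌊c⌋₊ + 1 - c, ?_, ?_, by ring⟩
    · linarith [Nat.lt_floor_add_one c]
    · linarith [Nat.floor_le hc.le]
  obtain ⟨C₀, h₀⟩ := exists_abs_qGammaDefect_natCast_le m
  obtain ⟨C₁, h₁⟩ := exists_abs_qGammaDefect_natCast_le (m + 1)
  obtain ⟨C₂, h₂⟩ := exists_abs_qGammaDefect_natCast_le (m + 2)
  refine ⟨|C₀| + 2 * |C₁| + |C₂| + (2 * c + 1), fun h hh N hN => ?_⟩
  have h0 := (h₀ h hh N hN).trans (mul_le_mul_of_nonneg_right (le_abs_self C₀) hh.le)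
  have h1 := (h₁ h hh N hN).trans (mul_le_mul_of_nonneg_right (le_abs_self C₁) hh.le)
  have h2 := (h₂ h hh N hN).trans (mul_le_mul_of_nonneg_right (le_abs_self C₂) hh.le)
  push_cast at h0 h1 h2
  have h3 := abs_qGammaDefect_add_one_sub_le hh hN hc
  have hconv := (convexOn_qGammaDefect hh N).2
  have hup := hconv (x := (m : ℝ) + 1) (y := (m : ℝ) + 1 + 1)
    (by simp only [Set.mem_Ioi]; positivity) (by simp only [Set.mem_Ioi]; positivity)
    ht0.le (sub_nonneg.2 ht1) (by ring)
  -- These weights exhibit m + 2 as a convex combination of c + 1 = m + 2 - t and m + 3, which gives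
  -- the lower bound at c + 1.
  have hlo := hconv (x := c + 1) (y := (m : ℝ) + 2 + 1) (a := 1 / (1 + t)) (b := t / (1 + t))
    (by simp only [Set.mem_Ioi]; positivity) (by simp only [Set.mem_Ioi]; positivity) (by positivity) (by positivity) (by field_simp)
  simp only [smul_eq_mul] at hup hlo
  rw [show t * ((m : ℝ) + 1) + (1 - t) * ((m : ℝ) + 1 + 1) = c + 1 by rw [hm]; ring] at hup
  rw [show 1 / (1 + t) * (c + 1) + t / (1 + t) * ((m : ℝ) + 2 + 1) = m + 1 + 1 by
    rw [hm]; field_simp; ring] at hlo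
  have hlo' : (1 + t) * qGammaDefect h N (m + 1 + 1) ≤
      qGammaDefect h N (c + 1) + t * qGammaDefect h N (m + 2 + 1) := by
    have := mul_le_mul_of_nonneg_left hlo (show 0 ≤ 1 + t by positivity)
    refine this.trans_eq ?_
    field_simp
  rw [abs_le] at *
  have n0 : 0 ≤ |C₀| * h := by positivity
  have n1 : 0 ≤ |C₁| * h := by positivity
  have n2 : 0 ≤ |C₂| * h := by positivity
  have e1 : t * qGammaDefect h N (m + 1) ≤ |C₀| * h := by nlinarith
  have e2 : (1 - t) * qGammaDefect h N (m + 1 + 1) ≤ |C₁| * h := by nlinarith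
  have e3 : t * qGammaDefect h N (m + 2 + 1) ≤ |C₂| * h := by nlinarith
  have e4 : -(2 * (|C₁| * h)) ≤ (1 + t) * qGammaDefect h N (m + 1 + 1) := by nlinarith
  constructor <;> nlinarith [h3.1, h3.2]

/-! ### The products (q^c; q)_∞ for q = e^{-h} -/

/-- The real infinite product `(exp (-h c); exp (-h))_∞`. -/
noncomputable def expPochInf (h c : ℝ) : ℝ := ∏' k : ℕ, (1 - Real.exp (-(h * (c + k))))

lemma exp_neg_mul_add_natCast (h c : ℝ) (k : ℕ) :
    Real.exp (-(h * (c + k))) = Real.exp (-(h * c)) * Real.exp (-h) ^ k := by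
  rw [← Real.exp_nat_mul, ← Real.exp_add]; congr 1; ring

lemma summable_exp_neg_mul_add_natCast {h : ℝ} (hh : 0 < h) (c : ℝ) :
    Summable fun k : ℕ => Real.exp (-(h * (c + k))) := by
  simp_rw [exp_neg_mul_add_natCast]
  refine (summable_geometric_of_lt_one (Real.exp_pos _).le ?_).mul_left _
  have := one_sub_exp_neg_pos hh
  linarith

lemma tsum_exp_neg_mul_add_natCast {h : ℝ} (hh : 0 < h) (c : ℝ) :
    ∑' k : ℕ, Real.exp (-(h * (c + k))) = Real.exp (-(h * c)) / (1 - Real.exp (-h)) := by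
  simp_rw [exp_neg_mul_add_natCast]
  have := one_sub_exp_neg_pos hh
  rw [tsum_mul_left, tsum_geometric_of_lt_one (Real.exp_pos _).le (by linarith), div_eq_mul_inv]

lemma multipliable_expPochInf {h : ℝ} (hh : 0 < h) (c : ℝ) :
    Multipliable fun k : ℕ => (1 - Real.exp (-(h * (c + k)))) := by
  simp_rw [sub_eq_add_neg]
  exact Real.multipliable_one_add_of_summable (summable_exp_neg_mul_add_natCast hh c).neg

lemma expPochInf_factor_pos {h c : ℝ} (hh : 0 < h) (hc : 0 < c) (k : ℕ) :
    0 < 1 - Real.exp (-(h * (c + k))) := one_sub_exp_neg_pos (by positivity)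

lemma expPochInf_pos {h c : ℝ} (hh : 0 < h) (hc : 0 < c) : 0 < expPochInf h c := by
  rw [expPochInf, ← Real.rexp_tsum_eq_tprod (expPochInf_factor_pos hh hc)]
  · exact Real.exp_pos _
  · simp_rw [sub_eq_add_neg]
    exact Real.summable_log_one_add_of_summable (summable_exp_neg_mul_add_natCast hh c).neg

lemma tendsto_prod_expPochInf {h : ℝ} (hh : 0 < h) (c : ℝ) :
    Tendsto (fun N => ∏ k ∈ Finset.range N, (1 - Real.exp (-(h * (c + k))))) atTop
      (nhds (expPochInf h c)) :=
  (multipliable_expPochInf hh c).hasProd.tendsto_prod_nat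

lemma expPochInf_eq_prod_mul {h : ℝ} (hh : 0 < h) (c : ℝ) (N : ℕ) :
    expPochInf h c = (∏ k ∈ Finset.range N, (1 - Real.exp (-(h * (c + k))))) *
      expPochInf h (c + N) := by
  refine tendsto_nhds_unique ((tendsto_prod_expPochInf hh c).comp (tendsto_add_atTop_nat N)) ?_
  refine ((tendsto_prod_expPochInf hh (c + N)).const_mul _).congr fun M => ?_
  simp only [Function.comp]
  rw [add_comm M N, Finset.prod_range_add]
  push_cast
  simp only [add_assoc]

lemma expPochInf_le_one {h c : ℝ} (hh : 0 < h) (hc : 0 < c) : expPochInf h c ≤ 1 := by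
  refine le_of_tendsto' (tendsto_prod_expPochInf hh c) fun N => ?_
  refine Finset.prod_le_one (fun k _ => (expPochInf_factor_pos hh hc k).le) fun k _ => ?_
  linarith [Real.exp_pos (-(h * (c + k)))]

lemma one_sub_sum_le_prod_one_sub {ι : Type*} (s : Finset ι) (f : ι → ℝ)
    (h0 : ∀ i ∈ s, 0 ≤ f i) (h1 : ∀ i ∈ s, f i ≤ 1) :
    1 - ∑ i ∈ s, f i ≤ ∏ i ∈ s, (1 - f i) := by
  classical
  induction s using Finset.induction_on with
  | empty => simp
  | insert a s ha ih =>
    rw [Finset.sum_insert ha, Finset.prod_insert ha]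
    have i0 := h0 a (Finset.mem_insert_self a s)
    have i1 := h1 a (Finset.mem_insert_self a s)
    have hs := ih (fun i hi => h0 i (Finset.mem_insert_of_mem hi))
      (fun i hi => h1 i (Finset.mem_insert_of_mem hi))
    have hp : ∏ i ∈ s, (1 - f i) ≤ 1 := Finset.prod_le_one
      (fun i hi => sub_nonneg.2 (h1 i (Finset.mem_insert_of_mem hi)))
      (fun i hi => by linarith [h0 i (Finset.mem_insert_of_mem hi)])
    nlinarith

lemma one_sub_expPochInf_le {h c : ℝ} (hh : 0 < h) (hc : 0 < c) :
    1 - expPochInf h c ≤ Real.exp (-(h * c)) / (1 - Real.exp (-h)) := by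
  rw [← tsum_exp_neg_mul_add_natCast hh c, sub_le_comm]
  refine ge_of_tendsto' (tendsto_prod_expPochInf hh c) fun N => ?_
  refine le_trans ?_ (one_sub_sum_le_prod_one_sub _ _ (fun k _ => (Real.exp_pos _).le)
    fun k _ => by linarith [expPochInf_factor_pos hh hc k])
  have := (summable_exp_neg_mul_add_natCast hh c).sum_le_tsum (Finset.range N)
    (fun k _ => (Real.exp_pos _).le)
  linarith

lemma expPochInf_le_expPochInf_add {h c : ℝ} (hh : 0 < h) (hc : 0 < c) (N : ℕ) :
    expPochInf h c ≤ expPochInf h (c + N) := by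
  rw [expPochInf_eq_prod_mul hh c N]
  refine mul_le_of_le_one_left (expPochInf_pos hh (by positivity)).le ?_
  refine Finset.prod_le_one (fun k _ => (expPochInf_factor_pos hh hc k).le) fun k _ => ?_
  linarith [Real.exp_pos (-(h * (c + k)))]

/-- The factor of index m is 1 - e^0. This vanishing expresses 1/(q; q)_k = 0 for k < 0 and lets a
series over ℕ be read as one over ℤ. -/
lemma expPochInf_eq_zero {h : ℝ} {m : ℕ} : expPochInf h (-m) = 0 := by
  refine tprod_of_exists_eq_zero ⟨m, ?_⟩
  simp

lemma qPochInf_exp {h : ℝ} (hh : 0 < h) (c : ℝ) :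
    qPochInf ((Real.exp (-(h * c)) : ℝ) : ℂ) (Real.exp (-h)) = (expPochInf h c : ℂ) := by
  have := (multipliable_expPochInf hh c).map_tprod Complex.ofRealHom Complex.continuous_ofReal
  simp only [Complex.ofRealHom_eq_coe] at this
  rw [qPochInf, expPochInf, this]
  congr 1
  ext k
  rw [exp_neg_mul_add_natCast]
  push_cast
  rfl

lemma qPoch_exp {h : ℝ} (hh : 0 < h) (c : ℝ) (k : ℕ) :
    qPoch ((Real.exp (-(h * c)) : ℝ) : ℂ) (Real.exp (-h)) k =
      ((expPochInf h c / expPochInf h (c + k) : ℝ) : ℂ) := by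
  rw [qPoch, qPochInf_exp hh, ← Complex.ofReal_pow, ← Complex.ofReal_mul,
    ← exp_neg_mul_add_natCast, qPochInf_exp hh]
  push_cast
  rfl

/-! ### Asymptotics of (q^c; q)_∞ as q → 1 -/

open Real in
/-- The partial products of `(q ^ c; q)_∞ / (q; q)_∞` compared with Euler's sequence for `Γ c`. -/
lemma prod_expPochInf_factor_div {h c : ℝ} (hh : 0 < h) (hc : 0 < c) {N : ℕ} (hN : 1 ≤ N) :
    (∏ k ∈ Finset.range (N + 1), (1 - exp (-(h * (c + k))))) =
      (∏ k ∈ Finset.range N, (1 - exp (-(h * (1 + k))))) *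
      (h ^ (1 - c) * (1 - exp (-(N * h))) ^ c / GammaSeq c N * exp (qGammaDefect h N c)) := by
  have hN' : (0 : ℝ) < N := by exact_mod_cast hN
  have e1 : ∀ c : ℝ, 0 < c → ∀ M : ℕ, ∏ k ∈ Finset.range M, (1 - exp (-(h * (c + k)))) =
      (∏ k ∈ Finset.range M, (c + k)) * h ^ M *
        exp (∑ k ∈ Finset.range M, logExpQuot ((c + k) * h)) := by
    intro c hc M
    rw [Real.exp_sum, ← Finset.card_range M, ← Finset.prod_const, Finset.card_range,
      ← Finset.prod_mul_distrib, ← Finset.prod_mul_distrib]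
    refine Finset.prod_congr rfl fun k _ => ?_
    rw [mul_comm h, one_sub_exp_neg_eq (by positivity)]
  have e2 : ∏ k ∈ Finset.range N, ((1 : ℝ) + k) = N.factorial := by
    rw [← Finset.prod_range_add_one_eq_factorial]; push_cast
    exact Finset.prod_congr rfl fun k _ => add_comm _ _
  have e3 : (1 - exp (-(N * h))) ^ c = N ^ c * h ^ c * exp (c * logExpQuot (N * h)) := by
    rw [one_sub_exp_neg_eq (by positivity), mul_rpow (by positivity) (exp_pos _).le,
      mul_rpow hN'.le hh.le, ← exp_mul, mul_comm c]
  have hp : 0 < ∏ k ∈ Finset.range (N + 1), (c + k) := Finset.prod_pos fun k _ => by positivity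
  have hf : (0 : ℝ) < N.factorial := by exact_mod_cast N.factorial_pos
  have hNc : 0 < (N : ℝ) ^ c := by positivity
  have hhc : h ^ (1 - c) * h ^ c = h := by rw [← rpow_add hh]; simp
  rw [e1 c hc, e1 1 one_pos, e2, e3, GammaSeq]
  -- Writing each factor 1 - e^{-t} as t times `exp (logExpQuot t)` separates the rational part,
  -- which is Euler's sequence, from the exponentials collected in the defect. The N + 1 factors at
  -- c match the N + 1 factors in the denominator of `GammaSeq`.
  have e4 : exp (qGammaDefect h N c) = exp (∑ k ∈ Finset.range (N + 1), logExpQuot ((c + k) * h)) /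
      (exp (∑ k ∈ Finset.range N, logExpQuot ((1 + k) * h)) * exp (c * logExpQuot (N * h))) := by
    rw [← exp_add, ← exp_sub, qGammaDefect]; congr 1; ring
  rw [e4]
  have x1 := exp_pos (∑ k ∈ Finset.range N, logExpQuot ((1 + k) * h))
  have x2 := exp_pos (c * logExpQuot (N * h))
  generalize exp (∑ k ∈ Finset.range N, logExpQuot ((1 + k) * h)) = X1 at *
  generalize exp (c * logExpQuot (N * h)) = X2 at *
  generalize exp (∑ k ∈ Finset.range (N + 1), logExpQuot ((c + k) * h)) = X3 at *
  generalize h ^ (1 - c) = Y at *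
  generalize h ^ c = Z at *
  field_simp
  linear_combination (-(X3 * h ^ N)) * hhc

-- The bound on the defect is uniform in N, so it survives the limit N → ∞ with h fixed. There 1 -
-- e^{-Nh} → 1 and Euler's sequence tends to Γ(c).
open Real in
lemma exists_abs_log_expPochInf_ratio_le {c : ℝ} (hc : 0 < c) : ∃ C : ℝ, ∀ h : ℝ, 0 < h →
    |log (expPochInf h c) - (log (expPochInf h 1) + (1 - c) * log h - log (Gamma c))| ≤ C * h := by
  obtain ⟨C, hC⟩ := exists_abs_qGammaDefect_le hc
  refine ⟨C, fun h hh => ?_⟩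
  have hG := Gamma_pos_of_pos hc
  have hE := expPochInf_pos hh hc
  have hE1 := expPochInf_pos hh one_pos
  have hGs : ∀ N : ℕ, 1 ≤ N → 0 < GammaSeq c N := fun N hN => by
    have hN' : (0 : ℝ) < N := by exact_mod_cast hN
    exact div_pos (by positivity) (Finset.prod_pos fun k _ => by positivity)
  have key : ∀ N : ℕ, 1 ≤ N → |log (∏ k ∈ Finset.range (N + 1), (1 - exp (-(h * (c + k))))) -
      (log (∏ k ∈ Finset.range N, (1 - exp (-(h * (1 + k))))) + (1 - c) * log h +
        c * log (1 - exp (-(N * h))) - log (GammaSeq c N))| ≤ C * h := by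
    intro N hN
    have hN' : (0 : ℝ) < N := by exact_mod_cast hN
    have h1 := hGs N hN
    have h2 : 0 < 1 - exp (-(N * h)) := one_sub_exp_neg_pos (by positivity)
    have h3 : 0 < ∏ k ∈ Finset.range N, (1 - exp (-(h * (1 + k)))) :=
      Finset.prod_pos fun k _ => expPochInf_factor_pos hh one_pos k
    rw [prod_expPochInf_factor_div hh hc hN, log_mul (by positivity) (by positivity),
      log_mul (by positivity) (by positivity), log_div (by positivity) (by positivity),
      log_mul (by positivity) (by positivity), log_rpow hh, log_rpow h2, log_exp]
    convert hC h hh N hN using 2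
    ring
  have t1 : Tendsto (fun N : ℕ => log (∏ k ∈ Finset.range (N + 1), (1 - exp (-(h * (c + k)))))) atTop
      (nhds (log (expPochInf h c))) :=
    ((tendsto_prod_expPochInf hh c).comp (tendsto_add_atTop_nat 1)).log hE.ne'
  have t2 := (tendsto_prod_expPochInf hh 1).log hE1.ne'
  have t3 : Tendsto (fun N : ℕ => log (1 - exp (-(N * h)))) atTop (nhds (log (1 - 0))) := by
    refine Tendsto.log (Tendsto.const_sub _ ?_) (by norm_num)
    refine tendsto_exp_neg_atTop_nhds_zero.comp ?_
    exact tendsto_natCast_atTop_atTop.atTop_mul_const hh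
  have t4 := (GammaSeq_tendsto_Gamma c).log hG.ne'
  have t5 := (t1.sub (((t2.add_const ((1 - c) * log h)).add (t3.const_mul c)).sub t4)).abs
  simp only [sub_zero, log_one, mul_zero, add_zero] at t5
  refine le_of_tendsto t5 ?_
  filter_upwards [eventually_ge_atTop 1] with N hN using key N hN

open UpperHalfPlane in
lemma eta_ofReal_mul_I {y : ℝ} (hy : 0 < y) :
    ModularForm.eta (y * Complex.I) =
      ((Real.exp (-(Real.pi * y / 12)) * expPochInf (2 * Real.pi * y) 1 : ℝ) : ℂ) := by
  have hpos : 0 < 2 * Real.pi * y := by positivity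
  have := (multipliable_expPochInf hpos 1).map_tprod Complex.ofRealHom Complex.continuous_ofReal
  simp only [Complex.ofRealHom_eq_coe] at this
  rw [ModularForm.eta, Complex.ofReal_mul, expPochInf, this]
  congr 1
  · rw [Function.Periodic.qParam, Complex.ofReal_exp]
    congr 1
    push_cast
    linear_combination (Real.pi * y / 12 : ℂ) * Complex.I_sq
  · congr 1
    ext k
    rw [ModularForm.eta_q_eq_cexp]
    push_cast
    congr 2
    linear_combination (2 * Real.pi * (k + 1) * y : ℂ) * Complex.I_sq

/-- This is η(-1/τ) = √(τ/i) η(τ) on the imaginary axis, with τ = iy and y = h/(2π). It exchanges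
the nomes e^{-h} and e^{-4π²/h}. -/
lemma expPochInf_one_transform {h : ℝ} (hh : 0 < h) :
    expPochInf h 1 = Real.sqrt (2 * Real.pi / h) * Real.exp (h / 24 - Real.pi ^ 2 / (6 * h)) *
      expPochInf (4 * Real.pi ^ 2 / h) 1 := by
  set y : ℝ := h / (2 * Real.pi) with hy
  have hpi := Real.pi_pos
  have hy0 : 0 < y := by positivity
  have hmem : (y * Complex.I) ∈ UpperHalfPlane.upperHalfPlaneSet := by
    simpa [UpperHalfPlane.upperHalfPlaneSet] using hy0
  have key := ModularForm.eta_comp_eq_csqrt_I_inv hmem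
  have e1 : (-1 / (y * Complex.I) : ℂ) = ((1 / y : ℝ) : ℂ) * Complex.I := by
    have : (y : ℂ) ≠ 0 := by exact_mod_cast hy0.ne'
    push_cast
    field_simp
    simp
  simp only [Function.comp, Pi.smul_apply, Pi.mul_apply, smul_eq_mul] at key
  rw [e1, eta_ofReal_mul_I hy0, eta_ofReal_mul_I (by positivity)] at key
  -- Splitting off the positive real factor isolates √i, which cancels and leaves an identity
  -- between real numbers.
  have e2 : Complex.sqrt (y * Complex.I) = (Real.sqrt y : ℝ) * Complex.sqrt Complex.I := by
    have hyc : (y : ℂ) ≠ 0 := by exact_mod_cast hy0.ne'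
    rw [sqrt_eq_exp (mul_ne_zero hyc Complex.I_ne_zero),
      sqrt_eq_exp Complex.I_ne_zero, Complex.log_ofReal_mul hy0 Complex.I_ne_zero,
      Real.sqrt_eq_rpow, Real.rpow_def_of_pos hy0, Complex.ofReal_exp, ← Complex.exp_add]
    congr 1
    push_cast
    ring
  have e3 : Complex.sqrt Complex.I ≠ 0 := by
    simp [Complex.sqrt]
  rw [e2] at key
  have e4 : (Complex.sqrt Complex.I)⁻¹ * ((Real.sqrt y : ℝ) * Complex.sqrt Complex.I *
      ((Real.exp (-(Real.pi * y / 12)) * expPochInf (2 * Real.pi * y) 1 : ℝ) : ℂ)) =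
      ((Real.sqrt y * (Real.exp (-(Real.pi * y / 12)) * expPochInf (2 * Real.pi * y) 1) : ℝ) : ℂ) := by
    push_cast
    field_simp
  rw [e4, Complex.ofReal_inj] at key
  have e5 : 2 * Real.pi * y = h := by rw [hy]; field_simp
  have e6 : 2 * Real.pi * (1 / y) = 4 * Real.pi ^ 2 / h := by rw [hy]; field_simp; norm_num
  rw [e5, e6] at key
  have e7 : Real.sqrt (2 * Real.pi / h) * Real.sqrt y = 1 := by
    rw [← Real.sqrt_mul (by positivity), Real.sqrt_eq_one, hy]; field_simp
  have e8 : Real.exp (h / 24 - Real.pi ^ 2 / (6 * h)) * Real.exp (-(Real.pi * y / 12)) =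
      Real.exp (-(Real.pi * (1 / y) / 12)) := by
    rw [← Real.exp_add, hy]; congr 1; field_simp; ring
  have e9 := Real.exp_pos (-(Real.pi * y / 12))
  rw [← e8] at key
  have : Real.exp (-(Real.pi * y / 12)) * expPochInf h 1 =
      Real.exp (-(Real.pi * y / 12)) * (Real.sqrt (2 * Real.pi / h) *
      Real.exp (h / 24 - Real.pi ^ 2 / (6 * h)) * expPochInf (4 * Real.pi ^ 2 / h) 1) := by
    linear_combination (-Real.exp (-(Real.pi * y / 12)) * expPochInf h 1) * e7 -
      Real.sqrt (2 * Real.pi / h) * key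
  exact mul_left_cancel₀ e9.ne' this

-- After the transformation the remaining product has nome e^{-4π²/h} and is 1 up to an
-- exponentially small error. Only O(h) is needed, so crude constants such as π > 3 suffice; the
-- term h/24 is absorbed as well.
open Real in
lemma exists_abs_log_expPochInf_one_sub_le : ∃ C : ℝ, ∀ h : ℝ, 0 < h → h ≤ 1 →
    |log (expPochInf h 1) - (log (2 * π / h) / 2 - π ^ 2 / (6 * h))| ≤ C * h := by
  refine ⟨1, fun h hh h1 => ?_⟩
  have hpi := pi_gt_three
  set H := 4 * π ^ 2 / h with hH
  have hH0 : 0 < H := by positivity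
  have hE := expPochInf_pos hH0 one_pos
  have hE1 := expPochInf_le_one hH0 one_pos
  have h36 : 36 / h ≤ H := by rw [hH]; gcongr; nlinarith
  have hHh : 36 ≤ H := le_trans (by rw [le_div_iff₀ hh]; linarith) h36
  have hexp : exp (-H) ≤ h / 36 := by
    have := add_one_le_exp H
    rw [exp_neg, inv_le_comm₀ (exp_pos _) (by positivity), inv_div]
    linarith
  have hlow : 1 - h / 18 ≤ expPochInf H 1 := by
    have := one_sub_expPochInf_le hH0 one_pos
    have h2 : exp (-(H * 1)) / (1 - exp (-H)) ≤ h / 18 := by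
      rw [mul_one, div_le_iff₀ (by linarith)]
      nlinarith
    linarith
  have hlog : |log (expPochInf H 1)| ≤ h / 2 := by
    rw [abs_le]
    refine ⟨?_, (log_nonpos hE.le hE1).trans (by positivity)⟩
    have h3 := one_sub_inv_le_log_of_pos hE
    have h4 : (expPochInf H 1)⁻¹ ≤ (1 - h / 18)⁻¹ := inv_anti₀ (by linarith) hlow
    have h5 : (1 - h / 18)⁻¹ ≤ 1 + h / 2 := by
      rw [inv_le_comm₀ (by linarith) (by linarith), inv_le_iff_one_le_mul₀ (by linarith)]
      nlinarith
    linarith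
  rw [expPochInf_one_transform hh, log_mul (by positivity) hE.ne', log_mul (by positivity)
    (by positivity), log_exp, log_sqrt (by positivity)]
  rw [abs_le] at hlog ⊢
  constructor <;> linarith [hlog.1, hlog.2]

/-- The asymptotics of `(q ^ c; q)_∞` as `q = exp (-h) → 1`, with relative error `O(h)`. -/
lemma exists_abs_log_expPochInf_sub_le {c : ℝ} (hc : 0 < c) :
    ∃ C : ℝ, 0 ≤ C ∧ ∀ h : ℝ, 0 < h → h ≤ 1 → |Real.log (expPochInf h c) -
      (Real.log (2 * Real.pi / h) / 2 - Real.pi ^ 2 / (6 * h) + (1 - c) * Real.log h -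
        Real.log (Real.Gamma c))| ≤ C * h := by
  obtain ⟨C₁, h₁⟩ := exists_abs_log_expPochInf_ratio_le hc
  obtain ⟨C₂, h₂⟩ := exists_abs_log_expPochInf_one_sub_le
  refine ⟨|C₁ + C₂|, abs_nonneg _, fun h hh h1 => ?_⟩
  have a1 := h₁ h hh
  have a2 := h₂ h hh h1
  have a3 := mul_le_mul_of_nonneg_right (le_abs_self (C₁ + C₂)) hh.le
  rw [abs_le] at a1 a2 ⊢
  constructor <;> linarith [a1.1, a1.2, a2.1, a2.2]

/-- A crude bound is enough, since it enters only the error controlled by e^{-2πn/λ_n}. For h ≤ 1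
the negative contributions are all at most a multiple of 1/h. -/
lemma exists_inv_expPochInf_le {c : ℝ} (hc : 0 < c) :
    ∃ C : ℝ, 0 ≤ C ∧ ∀ h : ℝ, 0 < h → h ≤ 1 → (expPochInf h c)⁻¹ ≤ Real.exp (C / h) := by
  obtain ⟨C, hC0, hC⟩ := exists_abs_log_expPochInf_sub_le hc
  have hpi := Real.pi_pos
  refine ⟨C + Real.pi ^ 2 / 6 + |1 - c| + |Real.log (Real.Gamma c)|, by positivity,
    fun h hh h1 => ?_⟩
  have hE := expPochInf_pos hh hc
  rw [← Real.exp_log (inv_pos.2 hE), Real.log_inv]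
  refine Real.exp_le_exp.2 ?_
  have b := (abs_le.1 (hC h hh h1)).1
  have hinv : 1 ≤ 1 / h := by rw [le_div_iff₀ hh]; linarith
  have b1 : 0 ≤ Real.log (2 * Real.pi / h) := Real.log_nonneg (by
    rw [le_div_iff₀ hh]; nlinarith [Real.pi_gt_three])
  have b2 : |(1 - c) * Real.log h| ≤ |1 - c| * (1 / h) := by
    rw [abs_mul]
    gcongr
    rw [abs_of_nonpos (Real.log_nonpos hh.le h1), ← Real.log_inv, ← one_div]
    exact (Real.log_le_sub_one_of_pos (by positivity)).trans (by linarith)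
  have b3 := le_abs_self (Real.log (Real.Gamma c))
  have b4 := mul_le_mul_of_nonneg_left hinv (abs_nonneg (Real.log (Real.Gamma c)))
  have b5 : C * h ≤ C * (1 / h) := by gcongr; linarith
  have b6 := (abs_le.1 b2).1
  have e : (C + Real.pi ^ 2 / 6 + |1 - c| + |Real.log (Real.Gamma c)|) / h =
    C * (1 / h) + Real.pi ^ 2 / (6 * h) + |1 - c| * (1 / h) +
      |Real.log (Real.Gamma c)| * (1 / h) := by field_simp
  rw [e]
  linarith

/-! ### Theta sums for small parameter, by Poisson summation -/

lemma norm_tsum_sub_sum_le {ι : Type*} (f : ι → ℂ) (s : Finset ι) (g : ι → ℝ) (hg : Summable g)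
    (hg0 : ∀ n, 0 ≤ g n) (h : ∀ n, n ∉ s → ‖f n‖ ≤ g n) :
    ‖∑' n, f n - ∑ n ∈ s, f n‖ ≤ ∑' n, g n := by
  classical
  have hb : ∀ n, ‖(if n ∈ s then 0 else f n)‖ ≤ g n := by
    intro n
    split_ifs with hn
    · simpa using hg0 n
    · exact h n hn
  have h1 : Summable fun n => if n ∈ s then 0 else f n := hg.of_norm_bounded hb
  have h2 : HasSum (fun n => if n ∈ s then f n else 0) (∑ n ∈ s, f n) := by
    rw [← Finset.sum_congr rfl fun n hn => if_pos (c := n ∈ s) (t := f n) (e := 0) hn]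
    exact hasSum_sum_of_ne_finset_zero (fun n hn => by simp [hn])
  have h3 : HasSum f ((∑' n, if n ∈ s then 0 else f n) + ∑ n ∈ s, f n) := by
    convert h1.hasSum.add h2 using 1
    ext n
    split_ifs <;> simp
  rw [h3.tsum_eq, add_sub_cancel_right]
  exact tsum_of_norm_bounded hg.hasSum hb

lemma summable_one_div_int_sq : Summable fun n : ℤ => 1 / (n : ℝ) ^ 2 :=
  Real.summable_one_div_int_pow.2 one_lt_two

lemma summable_exp_quadratic {a : ℝ} (ha : 0 < a) (v : ℝ) :
    Summable fun j : ℤ => Real.exp (2 * Real.pi * v * j - Real.pi * a * j ^ 2) := by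
  have := ((summable_jacobiTheta₂_term_iff (-v * Complex.I) (a * Complex.I)).2
    (by simpa using ha)).norm
  refine this.congr fun j => ?_
  rw [norm_jacobiTheta₂_term]
  congr 1
  simp
  ring

lemma Real.exp_neg_le_one_div {y : ℝ} (hy : 0 < y) : Real.exp (-y) ≤ 1 / y := by
  rw [Real.exp_neg, ← one_div]
  exact one_div_le_one_div_of_le hy (by linarith [Real.add_one_le_exp y])

lemma ofReal_one_div_sqrt {a : ℝ} (ha : 0 < a) :
    (1 / (a : ℂ) ^ (1 / 2 : ℂ)) = ((Real.sqrt (1 / a) : ℝ) : ℂ) := by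
  rw [Real.sqrt_div zero_le_one, Real.sqrt_one, Real.sqrt_eq_rpow]
  push_cast
  rw [Complex.ofReal_cpow ha.le]
  push_cast
  rfl

lemma abs_sub_mul_le_of_ofReal_eq {T P M δ : ℝ} {S : ℂ} (hP : 0 ≤ P) (h : (T : ℂ) = P * S)
    (hS : ‖S - M‖ ≤ δ) : |T - P * M| ≤ P * δ := by
  rw [← Real.norm_eq_abs, ← Complex.norm_real]
  push_cast
  rw [h, ← mul_sub, norm_mul, Complex.norm_real, Real.norm_eq_abs, abs_of_nonneg hP]
  gcongr

/-- The theta function `∑ exp (2 π v j - π a j ^ 2)` for small `a`. -/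
lemma exists_abs_theta_sub_le : ∃ C : ℝ, 0 ≤ C ∧ ∀ a : ℝ, 0 < a → ∀ v : ℝ,
    |∑' j : ℤ, Real.exp (2 * Real.pi * v * j - Real.pi * a * j ^ 2) -
      Real.sqrt (1 / a) * Real.exp (Real.pi * v ^ 2 / a) * 1| ≤
      Real.sqrt (1 / a) * Real.exp (Real.pi * v ^ 2 / a) * (C * a) := by
  refine ⟨∑' n : ℤ, 1 / (n : ℝ) ^ 2, tsum_nonneg fun n => by positivity, fun a ha v => ?_⟩
  have ha' : (a : ℂ) ≠ 0 := by exact_mod_cast ha.ne'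
  have key := Complex.tsum_exp_neg_quadratic (a := a) (by simpa using ha) v
  have e1 : ∀ n : ℤ, Complex.exp (-Real.pi / a * (n + Complex.I * v) ^ 2) =
      ((Real.exp (Real.pi * v ^ 2 / a) : ℝ) : ℂ) *
        Complex.exp (((-(Real.pi / a * n ^ 2) : ℝ) : ℂ) +
          ((-(2 * Real.pi * v * n / a) : ℝ) : ℂ) * Complex.I) := by
    intro n
    rw [Complex.ofReal_exp, ← Complex.exp_add]
    congr 1
    push_cast
    field_simp
    linear_combination (-v ^ 2 : ℂ) * Complex.I_sq
  simp_rw [e1] at key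
  rw [tsum_mul_left, ofReal_one_div_sqrt ha, ← mul_assoc, ← Complex.ofReal_mul] at key
  have e2 : (∑' n : ℤ, Complex.exp (-Real.pi * a * n ^ 2 + 2 * Real.pi * v * n)) =
      ((∑' j : ℤ, Real.exp (2 * Real.pi * v * j - Real.pi * a * j ^ 2) : ℝ) : ℂ) := by
    rw [Complex.ofReal_tsum]
    congr 1
    ext n
    push_cast
    congr 1
    ring
  rw [e2] at key
  refine abs_sub_mul_le_of_ofReal_eq (by positivity) key ?_
  -- Only the dual term n = 0 survives. The others have modulus e^{-πn²/a} ≤ a/n², which also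
  -- explains the constant Σ 1/n²; its n = 0 term is 1/0 = 0.
  have tail := norm_tsum_sub_sum_le (fun n : ℤ => Complex.exp (((-(Real.pi / a * n ^ 2) : ℝ) : ℂ) +
    ((-(2 * Real.pi * v * n / a) : ℝ) : ℂ) * Complex.I)) {0} (fun n => 1 / (n : ℝ) ^ 2 * a)
    (summable_one_div_int_sq.mul_right a) (fun n => by positivity) (by
      intro n hn
      have hn : (n : ℝ) ≠ 0 := by simpa using hn
      have hn2 : 0 < (n : ℝ) ^ 2 := by positivity
      have hpi := Real.pi_gt_three
      rw [Complex.exp_add, norm_mul, Complex.norm_exp_ofReal_mul_I, Complex.norm_exp_ofReal,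
        mul_one]
      refine (Real.exp_neg_le_one_div (by positivity)).trans ?_
      rw [show 1 / (n : ℝ) ^ 2 * a = 1 / (1 / a * n ^ 2) by field_simp]
      refine one_div_le_one_div_of_le (by positivity) ?_
      gcongr
      linarith)
  rw [tsum_mul_right] at tail
  simpa using tail

/-- The theta function `∑ (-1) ^ j exp (2 π v j - π a j ^ 2)` for small `a`. -/
lemma exists_abs_alternating_theta_sub_le : ∃ C : ℝ, 0 ≤ C ∧ ∀ a : ℝ, 0 < a → ∀ v : ℝ,
    |∑' j : ℤ, (-1 : ℝ) ^ j * Real.exp (2 * Real.pi * v * j - Real.pi * a * j ^ 2) -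
      Real.sqrt (1 / a) * Real.exp (Real.pi * v ^ 2 / a - Real.pi / (4 * a)) *
        (2 * Real.cos (Real.pi * v / a))| ≤
      Real.sqrt (1 / a) * Real.exp (Real.pi * v ^ 2 / a - Real.pi / (4 * a)) * (C * a) := by
  refine ⟨∑' n : ℤ, 1 / (n : ℝ) ^ 2, tsum_nonneg fun n => by positivity, fun a ha v => ?_⟩
  have ha' : (a : ℂ) ≠ 0 := by exact_mod_cast ha.ne'
  -- The sign (-1)^j = e^{πij} is absorbed by v ↦ v + i/2, which centres the dual Gaussian at 1/2.
  -- Since (n - 1/2)² = n(n - 1) + 1/4, the terms n = 0 and n = 1 tie and the common factor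
  -- e^{-π/(4a)} comes out.
  have key := Complex.tsum_exp_neg_quadratic (a := a) (by simpa using ha) (v + Complex.I / 2)
  have e1 : ∀ n : ℤ, Complex.exp (-Real.pi / a * (n + Complex.I * (v + Complex.I / 2)) ^ 2) =
      ((Real.exp (Real.pi * v ^ 2 / a - Real.pi / (4 * a)) : ℝ) : ℂ) *
        Complex.exp (((-(Real.pi / a * (n * (n - 1))) : ℝ) : ℂ) +
          ((-(2 * Real.pi * v * (n - 1 / 2) / a) : ℝ) : ℂ) * Complex.I) := by
    intro n
    rw [Complex.ofReal_exp, ← Complex.exp_add]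
    congr 1
    have : (Complex.I * (v + Complex.I / 2) : ℂ) = Complex.I * v - 1 / 2 := by
      linear_combination (1 / 2 : ℂ) * Complex.I_sq
    rw [this]
    push_cast
    field_simp
    linear_combination (-16 * v ^ 2 : ℂ) * Complex.I_sq
  simp_rw [e1] at key
  rw [tsum_mul_left, ofReal_one_div_sqrt ha, ← mul_assoc, ← Complex.ofReal_mul] at key
  have e2 : (∑' n : ℤ, Complex.exp (-Real.pi * a * n ^ 2 +
      2 * Real.pi * (v + Complex.I / 2) * n)) =
      ((∑' j : ℤ, (-1 : ℝ) ^ j * Real.exp (2 * Real.pi * v * j - Real.pi * a * j ^ 2) : ℝ) : ℂ) := by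
    rw [Complex.ofReal_tsum]
    congr 1
    ext n
    push_cast
    rw [← Complex.exp_pi_mul_I, ← Complex.exp_int_mul, ← Complex.exp_add]
    congr 1
    ring
  rw [e2] at key
  refine abs_sub_mul_le_of_ofReal_eq (by positivity) key ?_
  have tail := norm_tsum_sub_sum_le (fun n : ℤ =>
    Complex.exp (((-(Real.pi / a * (n * (n - 1))) : ℝ) : ℂ) +
      ((-(2 * Real.pi * v * (n - 1 / 2) / a) : ℝ) : ℂ) * Complex.I)) {0, 1}
    (fun n => 1 / (n : ℝ) ^ 2 * a)
    (summable_one_div_int_sq.mul_right a) (fun n => by positivity) (by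
      intro n hn
      simp only [Finset.mem_insert, Finset.mem_singleton, not_or] at hn
      have hn0 : (n : ℝ) ≠ 0 := by exact_mod_cast hn.1
      have hn2 : 0 < (n : ℝ) ^ 2 := by positivity
      have hpi := Real.pi_gt_three
      -- This holds for every integer except 1, where it fails; with 0 and 1 removed it reduces the
      -- tail to the same a/n² bound.
      have hnn : (n : ℝ) ^ 2 ≤ 2 * (n * (n - 1)) := by
        have : n ^ 2 ≤ 2 * (n * (n - 1)) := by
          rcases lt_or_ge n 0 with h | h
          · nlinarith
          · have : 2 ≤ n := by omega
            nlinarith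
        exact_mod_cast this
      rw [Complex.exp_add, norm_mul, Complex.norm_exp_ofReal_mul_I, Complex.norm_exp_ofReal,
        mul_one]
      have hpos : 0 < (n : ℝ) * (n - 1) := by linarith
      refine (Real.exp_neg_le_one_div (by positivity)).trans ?_
      rw [show 1 / (n : ℝ) ^ 2 * a = 1 / (1 / a * n ^ 2) by field_simp]
      refine one_div_le_one_div_of_le (by positivity) ?_
      rw [div_mul_eq_mul_div, div_mul_eq_mul_div]
      refine div_le_div_of_nonneg_right ?_ ha.le
      nlinarith)
  rw [tsum_mul_right, Finset.sum_pair (by norm_num)] at tail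
  have e3 : Complex.exp (((-(Real.pi / a * ((0 : ℤ) * ((0 : ℤ) - 1))) : ℝ) : ℂ) +
        ((-(2 * Real.pi * v * ((0 : ℤ) - 1 / 2) / a) : ℝ) : ℂ) * Complex.I) +
      Complex.exp (((-(Real.pi / a * ((1 : ℤ) * ((1 : ℤ) - 1))) : ℝ) : ℂ) +
        ((-(2 * Real.pi * v * ((1 : ℤ) - 1 / 2) / a) : ℝ) : ℂ) * Complex.I) =
      ((2 * Real.cos (Real.pi * v / a) : ℝ) : ℂ) := by
    push_cast
    rw [Complex.two_cos]
    congr 2 <;> field_simp <;> ring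
  rwa [e3] at tail

lemma exists_theta_le : ∃ C : ℝ, 0 ≤ C ∧ ∀ a : ℝ, 0 < a → ∀ v : ℝ,
    ∑' j : ℤ, Real.exp (2 * Real.pi * v * j - Real.pi * a * j ^ 2) ≤
      Real.sqrt (1 / a) * Real.exp (Real.pi * v ^ 2 / a) * (1 + C * a) := by
  obtain ⟨C, hC0, hC⟩ := exists_abs_theta_sub_le
  refine ⟨C, hC0, fun a ha v => ?_⟩
  have := (abs_le.1 (hC a ha v)).2
  linarith

/-! ### Coefficients of the series and comparison with a theta sum -/

/-- The coefficient `(q ^ α; q)_k / ((q; q)_k (q ^ β; q)_k)`, `q = exp (-h)`, of a basic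
hypergeometric series. -/
noncomputable def bhsCoeff {r s : ℕ} (α : Fin r → ℝ) (β : Fin s → ℝ) (h : ℝ) (k : ℕ) : ℝ :=
  (∏ j, expPochInf h (α j) / expPochInf h (α j + k)) /
    (expPochInf h 1 / expPochInf h (1 + k) * ∏ j, expPochInf h (β j) / expPochInf h (β j + k))

/-- The limit of `bhsCoeff α β h k` as `k → ∞`. -/
noncomputable def bhsCoeffLim {r s : ℕ} (α : Fin r → ℝ) (β : Fin s → ℝ) (h : ℝ) : ℝ :=
  (∏ j, expPochInf h (α j)) / (expPochInf h 1 * ∏ j, expPochInf h (β j))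

/-- The ratio of `bhsCoeff α β h k` and its limit, extended to real `k`. -/
noncomputable def bhsCoeffRatio {r s : ℕ} (α : Fin r → ℝ) (β : Fin s → ℝ) (h x : ℝ) : ℝ :=
  (expPochInf h (1 + x) * ∏ j, expPochInf h (β j + x)) / ∏ j, expPochInf h (α j + x)

/-- The constant in the bound for the deviation of `bhsCoeffRatio` from `1`. -/
noncomputable def bhsCoeffBound {r : ℕ} (s : ℕ) (α : Fin r → ℝ) (h : ℝ) : ℝ :=
  (r + s + 1) * (1 - Real.exp (-h))⁻¹ * ∏ j, (expPochInf h (α j))⁻¹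

section

variable {r s : ℕ} {α : Fin r → ℝ} {β : Fin s → ℝ} {h : ℝ}

lemma bhsCoeffLim_pos (hα : ∀ j, 0 < α j) (hβ : ∀ j, 0 < β j) (hh : 0 < h) :
    0 < bhsCoeffLim α β h :=
  div_pos (Finset.prod_pos fun j _ => expPochInf_pos hh (hα j))
    (mul_pos (expPochInf_pos hh one_pos) (Finset.prod_pos fun j _ => expPochInf_pos hh (hβ j)))

lemma bhsCoeff_eq (hα : ∀ j, 0 < α j) (hβ : ∀ j, 0 < β j) (hh : 0 < h) (k : ℕ) :
    bhsCoeff α β h k = bhsCoeffLim α β h * bhsCoeffRatio α β h k := by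
  have p : ∀ c : ℝ, 0 < c → expPochInf h (c + k) ≠ 0 := fun c hc =>
    (expPochInf_pos hh (by positivity)).ne'
  have p1 := p 1 one_pos
  have p2 := (expPochInf_pos hh one_pos).ne'
  have p3 : ∏ j, expPochInf h (α j + k) ≠ 0 := Finset.prod_ne_zero_iff.2 fun j _ => p _ (hα j)
  have p4 : ∏ j, expPochInf h (β j + k) ≠ 0 := Finset.prod_ne_zero_iff.2 fun j _ => p _ (hβ j)
  have p5 : ∏ j, expPochInf h (β j) ≠ 0 :=
    Finset.prod_ne_zero_iff.2 fun j _ => (expPochInf_pos hh (hβ j)).ne'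
  simp only [bhsCoeff, bhsCoeffLim, bhsCoeffRatio, Finset.prod_div_distrib]
  field_simp

lemma bhsCoeffRatio_eq_zero {k : ℤ} (hk : k < 0) : bhsCoeffRatio α β h k = 0 := by
  obtain ⟨m, rfl⟩ : ∃ m : ℕ, k = -(m : ℤ) - 1 := ⟨(-k - 1).toNat, by omega⟩
  have : (1 : ℝ) + ((-(m : ℤ) - 1 : ℤ) : ℝ) = -m := by push_cast; ring
  rw [bhsCoeffRatio, this, expPochInf_eq_zero, zero_mul, zero_div]

lemma one_le_prod_inv_expPochInf (hα : ∀ j, 0 < α j) (hh : 0 < h) :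
    1 ≤ ∏ j, (expPochInf h (α j))⁻¹ := by
  rw [Finset.prod_inv_distrib, one_le_inv₀ (Finset.prod_pos fun j _ => expPochInf_pos hh (hα j))]
  exact Finset.prod_le_one (fun j _ => (expPochInf_pos hh (hα j)).le)
    fun j _ => expPochInf_le_one hh (hα j)

lemma one_le_bhsCoeffBound (s : ℕ) (hα : ∀ j, 0 < α j) (hh : 0 < h) :
    1 ≤ bhsCoeffBound s α h := by
  have h1 := one_le_prod_inv_expPochInf hα hh
  have h2 : 1 ≤ (1 - Real.exp (-h))⁻¹ := (one_le_inv₀ (one_sub_exp_neg_pos hh)).2 (by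
    linarith [Real.exp_pos (-h)])
  have h3 : (1 : ℝ) ≤ r + s + 1 := by linarith [Nat.cast_nonneg (α := ℝ) r, Nat.cast_nonneg (α := ℝ) s]
  exact one_le_mul_of_one_le_of_one_le (one_le_mul_of_one_le_of_one_le h3 h2) h1

lemma one_sub_expPochInf_add_le (hh : 0 < h) {c : ℝ} (hc : 0 < c) (k : ℕ) :
    1 - expPochInf h (c + k) ≤ Real.exp (-(h * k)) * (1 - Real.exp (-h))⁻¹ := by
  have h1 := one_sub_exp_neg_pos hh
  refine (one_sub_expPochInf_le hh (by positivity)).trans ?_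
  rw [div_eq_mul_inv]
  gcongr
  linarith

lemma one_sub_prod_expPochInf_le {ι : Type*} [Fintype ι] {γ : ι → ℝ} (hγ : ∀ i, 0 < γ i)
    (hh : 0 < h) (k : ℕ) : 1 - ∏ i, expPochInf h (γ i + k) ≤
      Fintype.card ι * (Real.exp (-(h * k)) * (1 - Real.exp (-h))⁻¹) := by
  have h1 := one_sub_sum_le_prod_one_sub Finset.univ (fun i => 1 - expPochInf h (γ i + k))
    (fun i _ => sub_nonneg.2 (expPochInf_le_one hh (by have := hγ i; positivity)))
    (fun i _ => sub_le_self _ (expPochInf_pos hh (by have := hγ i; positivity)).le)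
  simp only [sub_sub_cancel] at h1
  have h2 := Finset.sum_le_card_nsmul Finset.univ (fun i => 1 - expPochInf h (γ i + k)) _
    (fun i _ => one_sub_expPochInf_add_le hh (hγ i) k)
  rw [nsmul_eq_mul, Finset.card_univ] at h2
  linarith

lemma prod_expPochInf_add_le_one {ι : Type*} [Fintype ι] {γ : ι → ℝ} (hγ : ∀ i, 0 < γ i)
    (hh : 0 < h) (k : ℕ) : ∏ i, expPochInf h (γ i + k) ≤ 1 :=
  Finset.prod_le_one (fun i _ => (expPochInf_pos hh (by have := hγ i; positivity)).le)
    fun i _ => expPochInf_le_one hh (by have := hγ i; positivity)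

/-- For k ≥ 0 each product is within a multiple of e^{-hk}/(1 - e^{-h}) of 1, and the denominator is
bounded below by its value at k = 0. For k < 0 the ratio is 0 and the bound is at least 1. One bound
over all of ℤ controls both the deviation of the coefficients and the missing negative half of the
theta sum. -/
lemma abs_bhsCoeffRatio_sub_one_le (hα : ∀ j, 0 < α j) (hβ : ∀ j, 0 < β j) (hh : 0 < h) (k : ℤ) :
    |bhsCoeffRatio α β h k - 1| ≤ bhsCoeffBound s α h * Real.exp (-(h * k)) := by
  rcases lt_or_ge k 0 with hk | hk
  · rw [bhsCoeffRatio_eq_zero hk, zero_sub, abs_neg, abs_one]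
    have hk' : (k : ℝ) ≤ 0 := by exact_mod_cast hk.le
    exact one_le_mul_of_one_le_of_one_le (one_le_bhsCoeffBound s hα hh)
      (Real.one_le_exp (by nlinarith))
  · lift k to ℕ using hk
    simp only [Int.cast_natCast]
    set τ := Real.exp (-(h * k)) * (1 - Real.exp (-h))⁻¹ with hτ
    have hτ0 : 0 ≤ τ := mul_nonneg (Real.exp_pos _).le (inv_nonneg.2 (one_sub_exp_neg_pos hh).le)
    have a1 := one_sub_prod_expPochInf_le hα hh k
    have a2 := prod_expPochInf_add_le_one hα hh k
    have b1 := one_sub_prod_expPochInf_le hβ hh k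
    have b2 := prod_expPochInf_add_le_one hβ hh k
    have b3 : 0 < ∏ j, expPochInf h (β j + k) :=
      Finset.prod_pos fun i _ => expPochInf_pos hh (by have := hβ i; positivity)
    have c1 := one_sub_expPochInf_add_le hh one_pos k
    have c2 := expPochInf_le_one hh (c := 1 + k) (by positivity)
    have c3 := expPochInf_pos hh (c := 1 + k) (by positivity)
    have a3 : 0 < ∏ j, expPochInf h (α j + k) :=
      Finset.prod_pos fun i _ => expPochInf_pos hh (by have := hα i; positivity)
    have a4 : (∏ j, expPochInf h (α j + k))⁻¹ ≤ ∏ j, (expPochInf h (α j))⁻¹ := by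
      rw [Finset.prod_inv_distrib]
      refine inv_anti₀ (Finset.prod_pos fun i _ => expPochInf_pos hh (hα i)) ?_
      exact Finset.prod_le_prod (fun i _ => (expPochInf_pos hh (hα i)).le)
        fun i _ => expPochInf_le_expPochInf_add hh (hα i) k
    rw [Fintype.card_fin, ← hτ] at a1 b1
    rw [← hτ] at c1
    rw [bhsCoeffRatio]
    generalize ∏ j, expPochInf h (α j + k) = P at *
    generalize ∏ j, expPochInf h (β j + k) = Q at *
    generalize expPochInf h (1 + k) = e at *
    have hr : 0 ≤ r * τ := by positivity
    have hs : 0 ≤ s * τ := by positivity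
    have hdiff : |e * Q - P| ≤ (r + s + 1) * τ := by
      rw [abs_le]
      constructor <;> nlinarith
    have : e * Q / P - 1 = (e * Q - P) * P⁻¹ := by field_simp
    rw [this, abs_mul, abs_of_pos (inv_pos.2 a3), bhsCoeffBound]
    calc |e * Q - P| * P⁻¹ ≤ ((r + s + 1) * τ) * ∏ j, (expPochInf h (α j))⁻¹ := by gcongr
      _ = _ := by rw [hτ]; ring

/-- Comparison of a (possibly alternating) basic hypergeometric series with a theta function. -/
lemma bhsCoeff_series (hα : ∀ j, 0 < α j) (hβ : ∀ j, 0 < β j) (hh : 0 < h) {a : ℝ} (ha : 0 < a)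
    (n : ℕ) (v : ℝ) {σ : ℝ} (hσ : |σ| = 1) :
    Summable (fun k : ℕ => bhsCoeff α β h k * σ ^ k *
      Real.exp (2 * Real.pi * v * k - Real.pi * a * (k ^ 2 - 4 * n * k))) ∧
    |∑' k : ℕ, bhsCoeff α β h k * σ ^ k *
      Real.exp (2 * Real.pi * v * k - Real.pi * a * (k ^ 2 - 4 * n * k)) -
      bhsCoeffLim α β h * Real.exp (4 * Real.pi * v * n + 4 * Real.pi * a * n ^ 2) *
        ∑' j : ℤ, σ ^ j * Real.exp (2 * Real.pi * v * j - Real.pi * a * j ^ 2)| ≤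
      bhsCoeffLim α β h * Real.exp (4 * Real.pi * v * n + 4 * Real.pi * a * n ^ 2) *
        (bhsCoeffBound s α h * Real.exp (-(2 * h * n)) *
          ∑' j : ℤ, Real.exp (2 * Real.pi * (v - h / (2 * Real.pi)) * j -
            Real.pi * a * j ^ 2)) := by
  have hpi := Real.pi_pos
  have hσ0 : σ ≠ 0 := by rintro rfl; simp at hσ
  have hσj : ∀ j : ℤ, |σ ^ j| = 1 := fun j => by rw [abs_zpow, hσ, one_zpow]
  have hL := bhsCoeffLim_pos hα hβ hh
  set W := bhsCoeffLim α β h * Real.exp (4 * Real.pi * v * n + 4 * Real.pi * a * n ^ 2) with hW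
  have hW0 : 0 < W := by positivity
  set G : ℤ → ℝ := fun j => σ ^ j * Real.exp (2 * Real.pi * v * j - Real.pi * a * j ^ 2) with hG
  set F : ℤ → ℝ := fun j => bhsCoeffRatio α β h ((j + 2 * n : ℤ) : ℝ) * G j with hF
  have hGs : Summable G := by
    refine (summable_exp_quadratic ha v).of_norm_bounded fun j => ?_
    rw [hG, Real.norm_eq_abs, abs_mul, hσj, one_mul, Real.abs_exp]
  -- The decay e^{-h(j + 2n)} splits into the small constant e^{-2hn} and a factor e^{-hj} that
  -- merely moves v to v - h/(2π), so the error is again a theta sum.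
  have hbd : ∀ j, ‖F j - G j‖ ≤ bhsCoeffBound s α h * Real.exp (-(2 * h * n)) *
      Real.exp (2 * Real.pi * (v - h / (2 * Real.pi)) * j - Real.pi * a * j ^ 2) := by
    intro j
    have h1 := abs_bhsCoeffRatio_sub_one_le hα hβ hh (j + 2 * n)
    have h2 : F j - G j = (bhsCoeffRatio α β h ((j + 2 * n : ℤ) : ℝ) - 1) * G j := by
      simp only [hF]; ring
    rw [h2, Real.norm_eq_abs, abs_mul, hG, abs_mul, hσj, one_mul, Real.abs_exp]
    refine (mul_le_mul_of_nonneg_right h1 (Real.exp_pos _).le).trans_eq ?_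
    rw [mul_assoc (bhsCoeffBound s α h), mul_assoc (bhsCoeffBound s α h), ← Real.exp_add,
      ← Real.exp_add]
    congr 2
    push_cast
    field_simp
    ring
  have hbs := (summable_exp_quadratic ha (v - h / (2 * Real.pi))).mul_left
    (bhsCoeffBound s α h * Real.exp (-(2 * h * n)))
  have hFG : Summable fun j => F j - G j := hbs.of_norm_bounded hbd
  have hFs : Summable F := by simpa using hFG.add hGs
  -- This substitution completes the square: k² - 4nk = j² - 4n².
  let i : ℕ → ℤ := fun k => k - 2 * n
  have hi : Function.Injective i := fun k l hkl => by simp only [i] at hkl; omega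
  have hsupp : ∀ x ∉ Set.range i, F x = 0 := by
    intro x hx
    have : x + 2 * n < 0 := by
      by_contra hcon
      exact hx ⟨(x + 2 * n).toNat, by simp only [i]; omega⟩
    simp only [hF, bhsCoeffRatio_eq_zero this, zero_mul]
  have hterm : ∀ k : ℕ, bhsCoeff α β h k * σ ^ k *
      Real.exp (2 * Real.pi * v * k - Real.pi * a * (k ^ 2 - 4 * n * k)) = W * F (i k) := by
    intro k
    -- The shift 2n is even, so the alternating sign is unaffected.
    have e1 : σ ^ (i k) = σ ^ k := by
      have : σ ^ 2 = 1 := by rw [← sq_abs, hσ, one_pow]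
      rw [show i k = k - (2 * n : ℕ) by simp [i], zpow_sub₀ hσ0, zpow_natCast, zpow_natCast,
        pow_mul, this, one_pow, div_one]
    have e2 : ((i k + 2 * n : ℤ) : ℝ) = k := by simp [i]
    have e3 : ((i k : ℤ) : ℝ) = k - 2 * n := by simp [i]
    simp only [hF, hG, hW]
    rw [e1, e2, e3, bhsCoeff_eq hα hβ hh]
    have e4 : Real.exp (2 * Real.pi * v * k - Real.pi * a * (k ^ 2 - 4 * n * k)) =
        Real.exp (4 * Real.pi * v * n + 4 * Real.pi * a * n ^ 2) *
        Real.exp (2 * Real.pi * v * (k - 2 * n) - Real.pi * a * (k - 2 * n) ^ 2) := by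
      rw [← Real.exp_add]; congr 1; ring
    rw [e4]; ring
  simp_rw [hterm]
  have hFi : Summable (F ∘ i) := (hi.summable_iff hsupp).2 hFs
  refine ⟨hFi.mul_left W, ?_⟩
  have hFt : ∑' k, F (i k) = ∑' j, F j := hi.tsum_eq fun x hx => by
    by_contra hcon
    exact hx (hsupp x hcon)
  rw [tsum_mul_left, hFt, ← mul_sub, abs_mul, abs_of_pos hW0, ← hFs.tsum_sub hGs, ← tsum_mul_left]
  exact mul_le_mul_of_nonneg_left (tsum_of_norm_bounded hbs.hasSum hbd) hW0.le

lemma exists_bhsCoeffBound_le (s : ℕ) (hα : ∀ j, 0 < α j) : ∃ C : ℝ, 0 ≤ C ∧ ∀ h : ℝ, 0 < h →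
    h ≤ 1 → bhsCoeffBound s α h ≤ Real.exp (C / h) := by
  choose C hC0 hC using fun j => exists_inv_expPochInf_le (hα j)
  refine ⟨(r + s) + 2 + ∑ j, C j, add_nonneg (by positivity)
    (Finset.sum_nonneg fun j _ => hC0 j), fun h hh h1 => ?_⟩
  rw [add_div, add_div, Real.exp_add, Real.exp_add, bhsCoeffBound, Finset.sum_div, Real.exp_sum]
  have hinv : 1 ≤ 1 / h := by rw [le_div_iff₀ hh]; linarith
  have e1 : (r : ℝ) + s + 1 ≤ Real.exp ((r + s) / h) := by
    refine (Real.add_one_le_exp _).trans (Real.exp_le_exp.2 ?_)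
    rw [div_eq_mul_one_div]
    exact le_mul_of_one_le_right (by positivity) hinv
  have e2 : (1 - Real.exp (-h))⁻¹ ≤ Real.exp (2 / h) := by
    have h2 : h / 2 ≤ 1 - Real.exp (-h) := by
      have : Real.exp (-h) ≤ (1 + h)⁻¹ := by
        rw [Real.exp_neg]
        exact inv_anti₀ (by positivity) (by linarith [Real.add_one_le_exp h])
      have h3 : (1 + h)⁻¹ ≤ 1 - h / 2 := by
        rw [inv_le_iff_one_le_mul₀ (by positivity)]
        nlinarith
      linarith
    refine (inv_anti₀ (by positivity) h2).trans ?_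
    rw [inv_div]
    linarith [Real.add_one_le_exp (2 / h)]
  have e3 : ∏ j, (expPochInf h (α j))⁻¹ ≤ ∏ j, Real.exp (C j / h) :=
    Finset.prod_le_prod (fun j _ => (inv_pos.2 (expPochInf_pos hh (hα j))).le)
      fun j _ => hC j h hh h1
  have p1 := inv_pos.2 (one_sub_exp_neg_pos hh)
  have p2 := one_le_prod_inv_expPochInf hα hh
  gcongr

end

/-! ### Leading term and total error -/

lemma Real.abs_exp_sub_one_le_mul_exp_abs (u : ℝ) :
    |Real.exp u - 1| ≤ |u| * Real.exp |u| := by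
  have h1 := Real.add_one_le_exp u
  have h2 := Real.add_one_le_exp (-u)
  have h3 : Real.exp u * Real.exp (-u) = 1 := by rw [← Real.exp_add]; simp
  have h4 := Real.exp_pos u
  have h5 : Real.exp u ≤ Real.exp |u| := Real.exp_le_exp.2 (le_abs_self u)
  have h6 : 1 ≤ Real.exp |u| := Real.one_le_exp (abs_nonneg u)
  have h7 := abs_nonneg u
  have h8 := le_abs_self u
  have h9 := neg_abs_le u
  rw [abs_le]
  constructor
  · nlinarith
  · have : Real.exp u - 1 ≤ u * Real.exp u := by nlinarith
    nlinarith

section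

variable {r s : ℕ} {α : Fin r → ℝ} {β : Fin s → ℝ} {ℓ ρ : ℝ}

/-- The limit coefficient as `q = exp (-π / L) → 1`, with relative error `O(1 / L)`. -/
lemma exists_bhsCoeffLim_eq (hα : ∀ j, 0 < α j) (hβ : ∀ k, 0 < β k)
    (hℓ : ℓ = ((s : ℝ) + 1 - r) / 2) (hρ : ρ = ∑ j, α j - ∑ k, β k - 1) :
    ∃ C : ℝ, 0 ≤ C ∧ ∀ L : ℝ, Real.pi ≤ L → ∃ u : ℝ, |u| ≤ C / L ∧
      bhsCoeffLim α β (Real.pi / L) = (∏ k, Real.Gamma (β k)) / (∏ j, Real.Gamma (α j)) *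
        (L ^ (ρ + ℓ) / ((2 : ℝ) ^ ℓ * Real.pi ^ (ρ + 2 * ℓ))) *
        Real.exp (ℓ * Real.pi * L / 3) * Real.exp u := by
  have hpi := Real.pi_pos
  choose A hA0 hA using fun j => exists_abs_log_expPochInf_sub_le (hα j)
  choose B hB0 hB using fun j => exists_abs_log_expPochInf_sub_le (hβ j)
  obtain ⟨D, hD0, hD⟩ := exists_abs_log_expPochInf_sub_le one_pos
  have hS0 : 0 ≤ ∑ j, A j + D + ∑ j, B j := by
    have := Finset.sum_nonneg fun j (_ : j ∈ Finset.univ) => hA0 j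
    have := Finset.sum_nonneg fun j (_ : j ∈ Finset.univ) => hB0 j
    positivity
  refine ⟨(∑ j, A j + D + ∑ j, B j) * Real.pi, by positivity, fun L hL => ?_⟩
  have hL0 : 0 < L := hpi.trans_le hL
  set h := Real.pi / L with hh_def
  have hh : 0 < h := by positivity
  have h1 : h ≤ 1 := (div_le_one hL0).2 hL
  have hGα : ∀ j, Real.Gamma (α j) ≠ 0 := fun j => (Real.Gamma_pos_of_pos (hα j)).ne'
  have hGβ : ∀ j, Real.Gamma (β j) ≠ 0 := fun j => (Real.Gamma_pos_of_pos (hβ j)).ne'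
  have pα : 0 < ∏ j, Real.Gamma (α j) :=
    Finset.prod_pos fun j _ => Real.Gamma_pos_of_pos (hα j)
  have pβ : 0 < ∏ j, Real.Gamma (β j) :=
    Finset.prod_pos fun j _ => Real.Gamma_pos_of_pos (hβ j)
  have eα := fun j => (expPochInf_pos hh (hα j)).ne'
  have eβ := fun j => (expPochInf_pos hh (hβ j)).ne'
  have e1 := (expPochInf_pos hh one_pos).ne'
  set main := (∏ k, Real.Gamma (β k)) / (∏ j, Real.Gamma (α j)) *
        (L ^ (ρ + ℓ) / ((2 : ℝ) ^ ℓ * Real.pi ^ (ρ + 2 * ℓ))) *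
        Real.exp (ℓ * Real.pi * L / 3) with hmain
  have hmain0 : 0 < main := by positivity
  have hlim := bhsCoeffLim_pos hα hβ hh
  refine ⟨Real.log (bhsCoeffLim α β h) - Real.log main, ?_, ?_⟩
  swap
  · rw [Real.exp_sub, Real.exp_log hlim, Real.exp_log hmain0]; field_simp
  have hlogh : Real.log h = Real.log Real.pi - Real.log L := Real.log_div hpi.ne' hL0.ne'
  have hlog2 : Real.log (2 * Real.pi / h) = Real.log 2 + Real.log L := by
    rw [show 2 * Real.pi / h = 2 * L by rw [hh_def]; field_simp, Real.log_mul two_ne_zero hL0.ne']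
  have hpih : Real.pi ^ 2 / (6 * h) = Real.pi * L / 6 := by rw [hh_def]; field_simp
  have lmain : Real.log main = ∑ k, Real.log (Real.Gamma (β k)) -
      ∑ j, Real.log (Real.Gamma (α j)) + ((ρ + ℓ) * Real.log L -
      (ℓ * Real.log 2 + (ρ + 2 * ℓ) * Real.log Real.pi)) + ℓ * Real.pi * L / 3 := by
    rw [hmain, Real.log_mul (by positivity) (by positivity), Real.log_exp,
      Real.log_mul (by positivity) (by positivity), Real.log_div pβ.ne' pα.ne',
      Real.log_div (by positivity) (by positivity), Real.log_mul (by positivity) (by positivity),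
      Real.log_rpow hL0, Real.log_rpow two_pos, Real.log_rpow hpi,
      Real.log_prod fun j _ => hGα j, Real.log_prod fun j _ => hGβ j]
  have llim : Real.log (bhsCoeffLim α β h) = ∑ j, Real.log (expPochInf h (α j)) -
      (Real.log (expPochInf h 1) + ∑ j, Real.log (expPochInf h (β j))) := by
    rw [bhsCoeffLim, Real.log_div (Finset.prod_ne_zero_iff.2 fun j _ => eα j)
      (mul_ne_zero e1 (Finset.prod_ne_zero_iff.2 fun j _ => eβ j)),
      Real.log_mul e1 (Finset.prod_ne_zero_iff.2 fun j _ => eβ j),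
      Real.log_prod fun j _ => eα j, Real.log_prod fun j _ => eβ j]
  have main_eq : ∀ {m : ℕ} (γ : Fin m → ℝ), ∑ j, ((Real.log 2 + Real.log L) / 2 -
      Real.pi * L / 6 + (1 - γ j) * (Real.log Real.pi - Real.log L) -
        Real.log (Real.Gamma (γ j))) =
      m * ((Real.log 2 + Real.log L) / 2 - Real.pi * L / 6) +
        (m - ∑ j, γ j) * (Real.log Real.pi - Real.log L) - ∑ j, Real.log (Real.Gamma (γ j)) := by
    intro m γ
    simp only [Finset.sum_sub_distrib, Finset.sum_add_distrib, ← Finset.sum_mul, Finset.sum_const,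
      Finset.card_univ, Fintype.card_fin, nsmul_eq_mul, mul_one]
    ring
  have kα : |∑ j, Real.log (expPochInf h (α j)) - (r * ((Real.log 2 + Real.log L) / 2 -
      Real.pi * L / 6) + (r - ∑ j, α j) * (Real.log Real.pi - Real.log L) -
      ∑ j, Real.log (Real.Gamma (α j)))| ≤ (∑ j, A j) * h := by
    rw [← main_eq, ← Finset.sum_sub_distrib, Finset.sum_mul]
    refine (Finset.abs_sum_le_sum_abs _ _).trans (Finset.sum_le_sum fun j _ => ?_)
    have := hA j h hh h1
    rwa [hlogh, hlog2, hpih] at this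
  have kβ : |∑ j, Real.log (expPochInf h (β j)) - (s * ((Real.log 2 + Real.log L) / 2 -
      Real.pi * L / 6) + (s - ∑ j, β j) * (Real.log Real.pi - Real.log L) -
      ∑ j, Real.log (Real.Gamma (β j)))| ≤ (∑ j, B j) * h := by
    rw [← main_eq, ← Finset.sum_sub_distrib, Finset.sum_mul]
    refine (Finset.abs_sum_le_sum_abs _ _).trans (Finset.sum_le_sum fun j _ => ?_)
    have := hB j h hh h1
    rwa [hlogh, hlog2, hpih] at this
  have k1 := hD h hh h1
  rw [hlogh, hlog2, hpih, Real.Gamma_one, Real.log_one] at k1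
  rw [lmain, llim, show (∑ j, A j + D + ∑ j, B j) * Real.pi / L =
    (∑ j, A j) * h + D * h + (∑ j, B j) * h by rw [hh_def]; ring]
  -- Numerator minus denominator counts r - s - 1 = -2ℓ products. The square roots thus give
  -- (2L)^{-ℓ}, the singular exponentials give e^{ℓπL/3}, and the powers of h = π/L combine to
  -- h^{-(ρ + 2ℓ)}.
  have hr : (r : ℝ) = s + 1 - 2 * ℓ := by rw [hℓ]; ring
  have hα_sum : ∑ j, α j = ρ + ∑ k, β k + 1 := by rw [hρ]; ring
  rw [hr, hα_sum] at kα
  rw [abs_le] at *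
  constructor <;> nlinarith only [kα.1, kα.2, kβ.1, kβ.2, k1.1, k1.2]

/-- The leading term of the asymptotics of the series, up to an oscillating factor. -/
noncomputable def bhsLeading {r s : ℕ} (α : Fin r → ℝ) (β : Fin s → ℝ) (ℓ ρ δ L : ℝ) (n : ℕ)
    (v : ℝ) : ℝ :=
  (∏ k, Real.Gamma (β k)) / (∏ j, Real.Gamma (α j)) *
    (L ^ (ρ + ℓ + 1 / 2) / (Real.sqrt ℓ * (2 : ℝ) ^ ℓ * Real.pi ^ (ρ + 2 * ℓ))) *
    Real.exp (Real.pi * L / ℓ * (v + 2 * n * ℓ / L) ^ 2 + ℓ * Real.pi * L / 3 -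
      δ * Real.pi * L / ℓ)

lemma bhsLeading_pos (hα : ∀ j, 0 < α j) (hβ : ∀ k, 0 < β k) (hℓ : 0 < ℓ) {L : ℝ} (hL : 0 < L)
    (δ : ℝ) (n : ℕ) (v : ℝ) : 0 < bhsLeading α β ℓ ρ δ L n v := by
  have hpi := Real.pi_pos
  have pα : 0 < ∏ j, Real.Gamma (α j) :=
    Finset.prod_pos fun j _ => Real.Gamma_pos_of_pos (hα j)
  have pβ : 0 < ∏ j, Real.Gamma (β j) :=
    Finset.prod_pos fun j _ => Real.Gamma_pos_of_pos (hβ j)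
  unfold bhsLeading
  positivity

/-- Three errors are added: replacing the coefficients by their limit, replacing the theta sum by
its main term, and replacing the limit coefficient by its asymptotic value. The last two are O(1/L),
and the first is the exponential. Taking σ, δ and M as parameters treats both signs at once. -/
lemma exists_abs_bhsCoeff_series_sub_le (hα : ∀ j, 0 < α j) (hβ : ∀ k, 0 < β k)
    (hℓ : ℓ = ((s : ℝ) + 1 - r) / 2) (hℓpos : 0 < ℓ) (hρ : ρ = ∑ j, α j - ∑ k, β k - 1)
    {σ δ : ℝ} (hσ : |σ| = 1) {M : ℝ → ℝ → ℝ} (hM : ∀ a v, |M a v| ≤ 2)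
    (hθ : ∃ C : ℝ, 0 ≤ C ∧ ∀ a : ℝ, 0 < a → ∀ v : ℝ,
      |∑' j : ℤ, σ ^ j * Real.exp (2 * Real.pi * v * j - Real.pi * a * j ^ 2) -
        Real.sqrt (1 / a) * Real.exp (Real.pi * v ^ 2 / a - δ * Real.pi / a) * M a v| ≤
      Real.sqrt (1 / a) * Real.exp (Real.pi * v ^ 2 / a - δ * Real.pi / a) * (C * a))
    {V : ℝ} (hV : 0 ≤ V) :
    ∃ C₁ C₂ : ℝ, ∀ L : ℝ, Real.pi ≤ L → ∀ (n : ℕ) (v : ℝ), |v| ≤ V →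
      |∑' k : ℕ, bhsCoeff α β (Real.pi / L) k * σ ^ k *
        Real.exp (2 * Real.pi * v * k - Real.pi * (ℓ / L) * (k ^ 2 - 4 * n * k)) -
        bhsLeading α β ℓ ρ δ L n v * M (ℓ / L) v| ≤
      bhsLeading α β ℓ ρ δ L n v * (C₂ / L + Real.exp (C₁ * L - 2 * Real.pi * n / L)) := by
  have hpi := Real.pi_pos
  obtain ⟨C, hC0, hC⟩ := hθ
  obtain ⟨C', hC'0, hC'⟩ := exists_theta_le
  obtain ⟨U, hU0, hU⟩ := exists_bhsCoeffLim_eq hα hβ hℓ hρ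
  obtain ⟨D, hD0, hD⟩ := exists_bhsCoeffBound_le s hα
  refine ⟨U + D / Real.pi + Real.pi * (V + 1) / ℓ + δ * Real.pi / ℓ + C' * ℓ,
    2 * (U * Real.exp U) + Real.exp U * (C * ℓ), fun L hL n v hv => ?_⟩
  have hL1 : 1 ≤ L := by linarith [Real.pi_gt_three]
  have hL0 : 0 < L := by linarith
  have ha : 0 < ℓ / L := by positivity
  have hh : 0 < Real.pi / L := by positivity
  have hh1 : Real.pi / L ≤ 1 := (div_le_one hL0).2 hL
  obtain ⟨u, hu, hlim⟩ := hU L hL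
  have hmain := (bhsCoeff_series hα hβ hh ha n v hσ).2
  have hlimpos := bhsCoeffLim_pos hα hβ hh
  have hP0 := bhsLeading_pos (ρ := ρ) hα hβ hℓpos hL0 δ n v
  set P := bhsLeading α β ℓ ρ δ L n v with hP
  set X := ∑' k : ℕ, bhsCoeff α β (Real.pi / L) k * σ ^ k *
    Real.exp (2 * Real.pi * v * k - Real.pi * (ℓ / L) * (k ^ 2 - 4 * n * k))
  set W := bhsCoeffLim α β (Real.pi / L) *
    Real.exp (4 * Real.pi * v * n + 4 * Real.pi * (ℓ / L) * n ^ 2) with hW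
  have hW0 : 0 < W := by positivity
  set Y := Real.sqrt (1 / (ℓ / L)) *
    Real.exp (Real.pi * v ^ 2 / (ℓ / L) - δ * Real.pi / (ℓ / L)) with hY
  have hY0 : 0 < Y := by positivity
  have hWY : W * Y = P * Real.exp u := by
    have e1 : Real.sqrt (1 / (ℓ / L)) = L ^ (1 / 2 : ℝ) / Real.sqrt ℓ := by
      rw [one_div_div, Real.sqrt_div hL0.le, Real.sqrt_eq_rpow]
    have e2 : L ^ (ρ + ℓ + 1 / 2) = L ^ (ρ + ℓ) * L ^ (1 / 2 : ℝ) := Real.rpow_add hL0 _ _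
    have e3 : Real.exp (Real.pi * L / ℓ * (v + 2 * n * ℓ / L) ^ 2 + ℓ * Real.pi * L / 3 -
      δ * Real.pi * L / ℓ) = Real.exp (4 * Real.pi * v * n + 4 * Real.pi * (ℓ / L) * n ^ 2) *
        Real.exp (Real.pi * v ^ 2 / (ℓ / L) - δ * Real.pi / (ℓ / L)) *
          Real.exp (ℓ * Real.pi * L / 3) := by
      rw [← Real.exp_add, ← Real.exp_add]
      congr 1
      field_simp
      ring
    rw [hW, hY, hP, bhsLeading, hlim, e1, e2, e3]
    field_simp
  have hθ1 := hC' (ℓ / L) ha (v - Real.pi / L / (2 * Real.pi))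
  have hθ2 : Real.sqrt (1 / (ℓ / L)) *
      Real.exp (Real.pi * (v - Real.pi / L / (2 * Real.pi)) ^ 2 / (ℓ / L)) * (1 + C' * (ℓ / L)) ≤
      Y * Real.exp (Real.pi * (V + 1) / ℓ + δ * Real.pi * L / ℓ + C' * ℓ) := by
    have f1 : 1 + C' * (ℓ / L) ≤ Real.exp (C' * ℓ) := by
      have : C' * (ℓ / L) ≤ C' * ℓ := by gcongr; exact div_le_self hℓpos.le hL1
      linarith [Real.add_one_le_exp (C' * ℓ)]
    -- The shift of v is 1/(2L), while the Gaussian exponent has the factor L, so the change is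
    -- bounded for |v| ≤ V.
    have f2 : Real.pi * (v - Real.pi / L / (2 * Real.pi)) ^ 2 / (ℓ / L) ≤
        Real.pi * v ^ 2 / (ℓ / L) + Real.pi * (V + 1) / ℓ := by
      have : Real.pi * (v - Real.pi / L / (2 * Real.pi)) ^ 2 / (ℓ / L) =
          Real.pi * v ^ 2 / (ℓ / L) + Real.pi * (-v + 1 / (4 * L)) / ℓ := by
        field_simp
        ring
      rw [this]
      have : 1 / (4 * L) ≤ 1 := by rw [div_le_one (by positivity)]; linarith
      have := neg_le_abs v
      gcongr
      linarith
    rw [hY, mul_assoc, mul_assoc]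
    refine mul_le_mul_of_nonneg_left ?_ (Real.sqrt_nonneg _)
    rw [← Real.exp_add]
    calc _ ≤ Real.exp (Real.pi * v ^ 2 / (ℓ / L) + Real.pi * (V + 1) / ℓ) *
          Real.exp (C' * ℓ) := by gcongr
      _ = _ := by
        rw [← Real.exp_add]; congr 1
        field_simp
        ring
  have hDL := hD _ hh hh1
  have hB0 : 0 ≤ bhsCoeffBound s α (Real.pi / L) :=
    zero_le_one.trans (one_le_bhsCoeffBound s hα hh)
  have huU : |u| ≤ U := hu.trans (div_le_self hU0 hL1)
  have hexpu : Real.exp u ≤ Real.exp U := Real.exp_le_exp.2 ((le_abs_self u).trans huU)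
  -- Every loss is at most exponential in L, including e^{δπL/ℓ}, which arises because the error
  -- theta sum lacks the damping of the main term when δ > 0.
  have hbig : Real.exp u * (bhsCoeffBound s α (Real.pi / L) * Real.exp (-(2 * (Real.pi / L) * n)) *
      Real.exp (Real.pi * (V + 1) / ℓ + δ * Real.pi * L / ℓ + C' * ℓ)) ≤
      Real.exp ((U + D / Real.pi + Real.pi * (V + 1) / ℓ + δ * Real.pi / ℓ + C' * ℓ) * L -
        2 * Real.pi * n / L) := by
    calc _ ≤ Real.exp U * (Real.exp (D / (Real.pi / L)) * Real.exp (-(2 * (Real.pi / L) * n)) *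
          Real.exp (Real.pi * (V + 1) / ℓ + δ * Real.pi * L / ℓ + C' * ℓ)) := by gcongr
      _ ≤ _ := by
        rw [← Real.exp_add, ← Real.exp_add, ← Real.exp_add]
        refine Real.exp_le_exp.2 ?_
        have g1 : U ≤ U * L := le_mul_of_one_le_right hU0 hL1
        have g2 : Real.pi * (V + 1) / ℓ ≤ Real.pi * (V + 1) / ℓ * L :=
          le_mul_of_one_le_right (by positivity) hL1
        have g3 : C' * ℓ ≤ C' * ℓ * L := le_mul_of_one_le_right (by positivity) hL1
        have g4 : D / (Real.pi / L) = D / Real.pi * L := by field_simp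
        have g5 : 2 * (Real.pi / L) * n = 2 * Real.pi * n / L := by ring
        have g6 : δ * Real.pi * L / ℓ = δ * Real.pi / ℓ * L := by ring
        rw [g4, g5, g6]
        linarith
  have s1 : |X - W * ∑' j : ℤ, σ ^ j * Real.exp (2 * Real.pi * v * j -
      Real.pi * (ℓ / L) * j ^ 2)| ≤ P * Real.exp ((U + D / Real.pi + Real.pi * (V + 1) / ℓ +
        δ * Real.pi / ℓ + C' * ℓ) * L - 2 * Real.pi * n / L) := by
    refine hmain.trans ?_
    calc _ ≤ W * (bhsCoeffBound s α (Real.pi / L) * Real.exp (-(2 * (Real.pi / L) * n)) *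
          (Y * Real.exp (Real.pi * (V + 1) / ℓ + δ * Real.pi * L / ℓ + C' * ℓ))) := by
          gcongr
          exact hθ1.trans hθ2
      _ = P * (Real.exp u * (bhsCoeffBound s α (Real.pi / L) *
          Real.exp (-(2 * (Real.pi / L) * n)) *
          Real.exp (Real.pi * (V + 1) / ℓ + δ * Real.pi * L / ℓ + C' * ℓ))) := by
          linear_combination (bhsCoeffBound s α (Real.pi / L) *
            Real.exp (-(2 * (Real.pi / L) * n)) *
            Real.exp (Real.pi * (V + 1) / ℓ + δ * Real.pi * L / ℓ + C' * ℓ)) * hWY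
      _ ≤ _ := by gcongr
  have s2 : |W * (∑' j : ℤ, σ ^ j * Real.exp (2 * Real.pi * v * j -
      Real.pi * (ℓ / L) * j ^ 2)) - W * (Y * M (ℓ / L) v)| ≤
      P * (Real.exp U * (C * ℓ) / L) := by
    rw [← mul_sub, abs_mul, abs_of_pos hW0]
    calc _ ≤ W * (Y * (C * (ℓ / L))) := by gcongr; exact hC (ℓ / L) ha v
      _ = P * (Real.exp u * (C * ℓ) / L) := by rw [← mul_assoc, hWY]; ring
      _ ≤ _ := by gcongr
  have s3 : |W * (Y * M (ℓ / L) v) - P * M (ℓ / L) v| ≤ P * (2 * (U * Real.exp U) / L) := by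
    have : W * (Y * M (ℓ / L) v) - P * M (ℓ / L) v = P * ((Real.exp u - 1) * M (ℓ / L) v) := by
      rw [← mul_assoc, hWY]; ring
    rw [this, abs_mul, abs_of_pos hP0, abs_mul]
    refine mul_le_mul_of_nonneg_left ?_ hP0.le
    calc _ ≤ (|u| * Real.exp |u|) * 2 := by
          gcongr
          · exact Real.abs_exp_sub_one_le_mul_exp_abs u
          · exact hM _ _
      _ ≤ (U / L * Real.exp U) * 2 := by gcongr
      _ = _ := by ring
  have s4 := (abs_sub_le X _ (P * M (ℓ / L) v)).trans
    (add_le_add s1 ((abs_sub_le _ _ _).trans (add_le_add s2 s3)))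
  refine s4.trans_eq ?_
  ring

end

/-! ### Consequences of admissibility -/

lemma IsAdmissibleScale.tendsto_atTop {lam : ℕ → ℝ} (h : IsAdmissibleScale lam) :
    Tendsto lam atTop atTop := by
  refine tendsto_atTop_mono' atTop ?_
    (Real.tendsto_log_atTop.comp tendsto_natCast_atTop_atTop)
  filter_upwards [h.tendsto_div_log.eventually_ge_atTop 1, eventually_ge_atTop 2] with n h1 h2
  have h2' : (1 : ℝ) < n := by exact_mod_cast h2
  rwa [le_div_iff₀ (Real.log_pos h2'), one_mul] at h1

/-- Once n/λ_n² ≥ C₁ + 1, the exponent is at most -λ_n, and e^{-λ_n} ≤ 1/λ_n. -/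
lemma IsAdmissibleScale.eventually_error_le {lam : ℕ → ℝ} (h : IsAdmissibleScale lam)
    (C₁ C₂ : ℝ) : ∀ᶠ n : ℕ in atTop, Real.pi ≤ lam n ∧
      C₂ / lam n + Real.exp (C₁ * lam n - 2 * Real.pi * n / lam n) ≤ (C₂ + 1) / lam n := by
  have hpi := Real.pi_gt_three
  filter_upwards [h.tendsto_atTop.eventually_ge_atTop Real.pi,
    h.tendsto_div_sq.eventually_ge_atTop (C₁ + 1)] with n h1 h2
  have h0 : 0 < lam n := by linarith
  refine ⟨h1, ?_⟩
  rw [add_div]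
  gcongr
  refine le_trans (Real.exp_le_exp.2 ?_) (Real.exp_neg_le_one_div h0)
  have h3 : (n : ℝ) / lam n = n / lam n ^ 2 * lam n := by field_simp
  have h4 : (C₁ + 1) * lam n ≤ n / lam n := by rw [h3]; gcongr
  have h5 : (n : ℝ) / lam n ≤ 2 * Real.pi * n / lam n := by
    gcongr
    exact le_mul_of_one_le_left (Nat.cast_nonneg n) (by linarith)
  linarith

/-! ### Translation to basic hypergeometric series -/

section

variable {r s : ℕ} {α : Fin r → ℝ} {β : Fin s → ℝ} {ℓ ρ : ℝ}

/-- The sign in the argument cancels the (-1)^{k(s+1-r)} of the series and leaves σ^k. The -1 in 4n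
- 1 cancels the factor q^{-ℓ}, which leaves the exponent ℓ(k² - 4nk). -/
lemma bhsTerm_exp_eq (hℓ : ℓ = ((s : ℝ) + 1 - r) / 2) {L : ℝ} (hL : 0 < L) (n : ℕ) (v : ℝ)
    {q : ℝ} (hq : q = Real.exp (-Real.pi / L)) {a : Fin r → ℂ} {b : Fin s → ℂ}
    (ha : ∀ j, a j = ((q ^ α j : ℝ) : ℂ)) (hb : ∀ k, b k = ((q ^ β k : ℝ) : ℂ))
    {σ : ℝ} {x : ℂ}
    (hx : x = σ * (-1 : ℂ) ^ ((s : ℤ) + 1 - (r : ℤ)) *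
      ((Real.exp (2 * Real.pi * v) * q ^ (-ℓ * (4 * (n : ℝ) - 1)) : ℝ) : ℂ)) (k : ℕ) :
    bhsTerm a b q x k = ((bhsCoeff α β (Real.pi / L) k * σ ^ k *
      Real.exp (2 * Real.pi * v * k - Real.pi * (ℓ / L) * (k ^ 2 - 4 * n * k)) : ℝ) : ℂ) := by
  have hh : 0 < Real.pi / L := div_pos Real.pi_pos hL
  have hq' : q = Real.exp (-(Real.pi / L)) := by rw [hq, neg_div]
  have hpow : ∀ c : ℝ, q ^ c = Real.exp (-(Real.pi / L * c)) := fun c => by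
    rw [hq', ← Real.exp_mul]; congr 1; ring
  have hqq : (q : ℂ) = ((Real.exp (-(Real.pi / L * 1)) : ℝ) : ℂ) := by rw [hq', mul_one]
  have hbe : bhsEll r s = ℓ := by rw [hℓ, bhsEll]
  have h1 : ∀ c : ℝ, qPoch ((q ^ c : ℝ) : ℂ) q k =
      ((expPochInf (Real.pi / L) c / expPochInf (Real.pi / L) (c + k) : ℝ) : ℂ) := fun c => by
    rw [hpow, hq', qPoch_exp hh]
  have h2 : qPoch (q : ℂ) q k =
      ((expPochInf (Real.pi / L) 1 / expPochInf (Real.pi / L) (1 + k) : ℝ) : ℂ) := by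
    have := h1 1
    rwa [Real.rpow_one] at this
  have hs0 : ((-1 : ℂ) ^ ((s : ℤ) + 1 - (r : ℤ))) ≠ 0 := zpow_ne_zero _ (by norm_num)
  have hsign : (-1 : ℂ) ^ ((k : ℤ) * ((s : ℤ) + 1 - (r : ℤ))) =
      ((-1 : ℂ) ^ ((s : ℤ) + 1 - (r : ℤ))) ^ k := by
    rw [mul_comm, zpow_mul, zpow_natCast]
  have hexp : (Real.exp (2 * Real.pi * v) * q ^ (-ℓ * (4 * (n : ℝ) - 1))) ^ k *
      (q ^ (-ℓ)) ^ k * q ^ (ℓ * (k : ℝ) ^ 2) =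
      Real.exp (2 * Real.pi * v * k - Real.pi * (ℓ / L) * (k ^ 2 - 4 * n * k)) := by
    rw [hpow, hpow, hpow, ← Real.exp_add, ← Real.exp_nat_mul, ← Real.exp_nat_mul, ← Real.exp_add,
      ← Real.exp_add]
    congr 1
    ring
  rw [bhsTerm, hbe, h2, hsign, hx, ← hexp]
  simp_rw [ha, hb, h1]
  rw [bhsCoeff]
  generalize (-1 : ℂ) ^ ((s : ℤ) + 1 - (r : ℤ)) = S at *
  generalize Real.exp (2 * Real.pi * v) * q ^ (-ℓ * (4 * (n : ℝ) - 1)) = E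
  push_cast
  rw [mul_pow, mul_pow, mul_pow]
  field_simp

/-- Both asymptotic formulas at once: `σ = ± 1` is the sign in the argument of the series. -/
lemma bhs_asymptotics (hα : ∀ j, 0 < α j) (hβ : ∀ k, 0 < β k)
    (hℓ : ℓ = ((s : ℝ) + 1 - r) / 2) (hℓpos : 0 < ℓ) (hρ : ρ = ∑ j, α j - ∑ k, β k - 1)
    {lam : ℕ → ℝ} (hlam : IsAdmissibleScale lam)
    {q : ℕ → ℝ} (hq : ∀ n, q n = Real.exp (-Real.pi / lam n))
    {a : ℕ → Fin r → ℂ} (ha : ∀ n j, a n j = ((q n ^ α j : ℝ) : ℂ))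
    {b : ℕ → Fin s → ℂ} (hb : ∀ n k, b n k = ((q n ^ β k : ℝ) : ℂ))
    {σ δ : ℝ} (hσ : |σ| = 1) {M : ℝ → ℝ → ℝ} (hM : ∀ a v, |M a v| ≤ 2)
    (hθ : ∃ C : ℝ, 0 ≤ C ∧ ∀ a : ℝ, 0 < a → ∀ v : ℝ,
      |∑' j : ℤ, σ ^ j * Real.exp (2 * Real.pi * v * j - Real.pi * a * j ^ 2) -
        Real.sqrt (1 / a) * Real.exp (Real.pi * v ^ 2 / a - δ * Real.pi / a) * M a v| ≤
      Real.sqrt (1 / a) * Real.exp (Real.pi * v ^ 2 / a - δ * Real.pi / a) * (C * a))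
    {x : ℕ → ℝ → ℂ}
    (hx : ∀ n v, x n v = σ * (-1 : ℂ) ^ ((s : ℤ) + 1 - (r : ℤ)) *
      ((Real.exp (2 * Real.pi * v) * q n ^ (-ℓ * (4 * (n : ℝ) - 1)) : ℝ) : ℂ)) :
    (∀ n : ℕ, 1 ≤ n → ∀ v : ℝ, Summable (bhsTerm (a n) (b n) (q n) (x n v))) ∧
    ∃ ε : ℕ → ℝ → ℂ, IsBigOInvLocUnif lam ε ∧ ∀ n : ℕ, 1 ≤ n → ∀ v : ℝ,
      bhs (a n) (b n) (q n) (x n v) =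
        (bhsLeading α β ℓ ρ δ (lam n) n v : ℂ) * ((M (ℓ / lam n) v : ℂ) + ε n v) := by
  have hpi := Real.pi_pos
  set T : ℕ → ℝ → ℝ := fun n v => ∑' k : ℕ, bhsCoeff α β (Real.pi / lam n) k * σ ^ k *
    Real.exp (2 * Real.pi * v * k - Real.pi * (ℓ / lam n) * (k ^ 2 - 4 * n * k)) with hT
  have hterm : ∀ n : ℕ, 1 ≤ n → ∀ v, bhsTerm (a n) (b n) (q n) (x n v) = fun k : ℕ =>
      ((bhsCoeff α β (Real.pi / lam n) k * σ ^ k * Real.exp (2 * Real.pi * v * k -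
        Real.pi * (ℓ / lam n) * (k ^ 2 - 4 * n * k)) : ℝ) : ℂ) := fun n hn v => funext fun k =>
    bhsTerm_exp_eq hℓ (hlam.pos n hn) n v (hq n) (ha n) (hb n) (hx n v) k
  have hbhs : ∀ n : ℕ, 1 ≤ n → ∀ v, bhs (a n) (b n) (q n) (x n v) = (T n v : ℂ) := by
    intro n hn v
    rw [bhs, hterm n hn v, hT, Complex.ofReal_tsum]
  -- Here ε is defined by solving the identity, so the formula is exact for every n ≥ 1 and the
  -- estimate matters only for large n.
  refine ⟨fun n hn v => ?_, fun n v => ((T n v / bhsLeading α β ℓ ρ δ (lam n) n v -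
    M (ℓ / lam n) v : ℝ) : ℂ), fun K hK => ?_, fun n hn v => ?_⟩
  · rw [hterm n hn v]
    have hL := hlam.pos n hn
    exact Complex.summable_ofReal.2 (bhsCoeff_series hα hβ (by positivity)
      (a := ℓ / lam n) (by positivity) n v hσ).1
  · obtain ⟨V, hV⟩ := hK.isBounded.exists_norm_le
    obtain ⟨C₁, C₂, h⟩ := exists_abs_bhsCoeff_series_sub_le hα hβ hℓ hℓpos hρ hσ hM hθ
      (abs_nonneg V)
    obtain ⟨N, hN⟩ := eventually_atTop.1 (hlam.eventually_error_le C₁ C₂)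
    refine ⟨C₂ + 1, N, fun n hn v hv => ?_⟩
    obtain ⟨h1, h2⟩ := hN n hn
    have hP := bhsLeading_pos (ρ := ρ) hα hβ hℓpos (hpi.trans_le h1) δ n v
    rw [Complex.norm_real, Real.norm_eq_abs]
    refine le_trans ?_ h2
    have h3 := h (lam n) h1 n v ((hV v hv).trans (le_abs_self V))
    rw [show T n v / bhsLeading α β ℓ ρ δ (lam n) n v - M (ℓ / lam n) v =
      (T n v - bhsLeading α β ℓ ρ δ (lam n) n v * M (ℓ / lam n) v) /
        bhsLeading α β ℓ ρ δ (lam n) n v by field_simp, abs_div, abs_of_pos hP,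
      div_le_iff₀' hP]
    exact h3
  · have hP := bhsLeading_pos (ρ := ρ) hα hβ hℓpos (hlam.pos n hn) δ n v
    rw [hbhs n hn v, ← Complex.ofReal_add, ← Complex.ofReal_mul]
    congr 1
    field_simp
    ring

end

theorem corollary3p4 (r s : ℕ) (α : Fin r → ℝ) (β : Fin s → ℝ)
    (hα : ∀ j, 0 < α j) (hβ : ∀ k, 0 < β k)
    (ℓ ρ : ℝ) (hℓ : ℓ = ((s : ℝ) + 1 - r) / 2) (hℓpos : 0 < ℓ)
    (hρ : ρ = ∑ j, α j - ∑ k, β k - 1)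
    (lam : ℕ → ℝ) (hlam : IsAdmissibleScale lam)
    (q : ℕ → ℝ) (hq : ∀ n, q n = Real.exp (-Real.pi / lam n))
    (a : ℕ → Fin r → ℂ) (ha : ∀ n j, a n j = ((q n ^ α j : ℝ) : ℂ))
    (b : ℕ → Fin s → ℂ) (hb : ∀ n k, b n k = ((q n ^ β k : ℝ) : ℂ))
    (x y : ℕ → ℝ → ℂ)
    (hx : ∀ n v, x n v = (-1 : ℂ) ^ ((s : ℤ) + 1 - (r : ℤ)) *
      ((Real.exp (2 * Real.pi * v) * q n ^ (-ℓ * (4 * (n : ℝ) - 1)) : ℝ) : ℂ))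
    (hy : ∀ n v, y n v = (-1 : ℂ) ^ ((s : ℤ) - (r : ℤ)) *
      ((Real.exp (2 * Real.pi * v) * q n ^ (-ℓ * (4 * (n : ℝ) - 1)) : ℝ) : ℂ)) :
    (∀ n : ℕ, 1 ≤ n → ∀ v : ℝ,
      Summable (bhsTerm (a n) (b n) (q n) (x n v)) ∧
      Summable (bhsTerm (a n) (b n) (q n) (y n v))) ∧
    (∃ ε : ℕ → ℝ → ℂ, IsBigOInvLocUnif lam ε ∧ ∀ n : ℕ, 1 ≤ n → ∀ v : ℝ,
      bhs (a n) (b n) (q n) (x n v) =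
        (((∏ k, Real.Gamma (β k)) / (∏ j, Real.Gamma (α j)) *
          (lam n ^ (ρ + ℓ + 1 / 2) /
            (Real.sqrt ℓ * (2 : ℝ) ^ ℓ * Real.pi ^ (ρ + 2 * ℓ))) *
          Real.exp (Real.pi * lam n / ℓ * (v + 2 * n * ℓ / lam n) ^ 2 +
            ℓ * Real.pi * lam n / 3) : ℝ) : ℂ) *
        (1 + ε n v)) ∧
    (∃ ε : ℕ → ℝ → ℂ, IsBigOInvLocUnif lam ε ∧ ∀ n : ℕ, 1 ≤ n → ∀ v : ℝ,
      bhs (a n) (b n) (q n) (y n v) =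
        (((∏ k, Real.Gamma (β k)) / (∏ j, Real.Gamma (α j)) *
          (lam n ^ (ρ + ℓ + 1 / 2) /
            (Real.sqrt ℓ * (2 : ℝ) ^ (ℓ - 1) * Real.pi ^ (ρ + 2 * ℓ))) *
          Real.exp (Real.pi * lam n / ℓ * (v + 2 * n * ℓ / lam n) ^ 2 +
            ℓ * Real.pi * lam n / 3 - Real.pi * lam n / (4 * ℓ)) : ℝ) : ℂ) *
        ((Real.cos (Real.pi * lam n * v / ℓ) : ℂ) + ε n v)) := by

  obtain ⟨hsx, ε, hε, hxe⟩ := bhs_asymptotics hα hβ hℓ hℓpos hρ hlam hq ha hb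
    (σ := 1) (δ := 0) (M := fun _ _ => 1) abs_one (fun _ _ => by norm_num)
    (by simpa only [one_zpow, one_mul, zero_mul, zero_div, sub_zero] using exists_abs_theta_sub_le)
    (x := x) (fun n v => by rw [hx, Complex.ofReal_one, one_mul])
  obtain ⟨hsy, ε', hε', hye⟩ := bhs_asymptotics hα hβ hℓ hℓpos hρ hlam hq ha hb
    (σ := -1) (δ := 1 / 4) (M := fun a v => 2 * Real.cos (Real.pi * v / a)) (by norm_num)
    (fun a v => by
      rw [abs_mul, abs_two]
      linarith [Real.abs_cos_le_one (Real.pi * v / a)])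
    (by
      have h4 : ∀ a : ℝ, 1 / 4 * Real.pi / a = Real.pi / (4 * a) := fun a => by
        rw [mul_comm, mul_one_div, div_div]
      simpa only [h4] using exists_abs_alternating_theta_sub_le)
    (x := y) (fun n v => by
      rw [hy, show (s : ℤ) + 1 - r = (s - r) + 1 by ring, zpow_add_one₀ (by norm_num)]
      push_cast
      ring)
  refine ⟨fun n hn v => ⟨hsx n hn v, hsy n hn v⟩, ⟨ε, hε, fun n hn v => ?_⟩,
    ⟨fun n v => ε' n v / 2, fun K hK => ?_, fun n hn v => ?_⟩⟩
  · rw [hxe n hn v, bhsLeading]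
    simp only [zero_mul, zero_div, sub_zero, Complex.ofReal_one]
  · obtain ⟨C, N, h⟩ := hε' K hK
    refine ⟨C / 2, N, fun n hn v hv => ?_⟩
    rw [norm_div, Complex.norm_ofNat, div_right_comm]
    exact div_le_div_of_nonneg_right (h n hn v hv) zero_le_two
  · have hL := hlam.pos n hn
    have e1 : Real.pi * v / (ℓ / lam n) = Real.pi * lam n * v / ℓ := by field_simp
    -- The 2 of 2cos is moved into the prefactor, turning 2^ℓ into 2^{ℓ-1}; this is why the error
    -- term was halved.
    have e2 : (2 : ℝ) ^ (ℓ - 1) = 2 ^ ℓ / 2 := by rw [Real.rpow_sub_one two_ne_zero]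
    have e3 : 1 / 4 * Real.pi * lam n / ℓ = Real.pi * lam n / (4 * ℓ) := by field_simp
    have e4 : lam n ^ (ρ + ℓ + 1 / 2) / (Real.sqrt ℓ * (2 ^ ℓ / 2) * Real.pi ^ (ρ + 2 * ℓ)) =
        2 * (lam n ^ (ρ + ℓ + 1 / 2) / (Real.sqrt ℓ * 2 ^ ℓ * Real.pi ^ (ρ + 2 * ℓ))) := by
      field_simp
    rw [hye n hn v, bhsLeading, e1, e2, e3, e4]
    push_cast
    ring
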